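/- Fix integers $K,N\ge 1$ with $K/N=1/2$, a decoding delay $\Delta\in\{0,1,2,\dots\}$, a memory $\alpha\in\{0,1,2,\dots\}\cup\{\infty\}$ and a probability $p\in(1/2,1]$. In each slot $t\ge1$ a vector $\mathbf s(t)$ of $K$ source symbols over $GF(2^q)$ is encoded systematically into a packet of $N$ symbols: the first $K$ are the symbols of $\mathbf s(t)$, and each of the other $N-K$ is a linear combination of all symbols of $\mathbf s(\max(t-\alpha,1)),\dots,\mathbf s(t)$ (of $\mathbf s(1),\dots,\mathbf s(t)$ if $\alpha=\infty$), whose coefficients are independent and uniform on $GF(2^q)\setminus\{0\}$. Each packet is delivered entirely with probability $p$ and erased entirely with probability $1-p$, independently over the slots and of the coefficients. The vector $\mathbf s(t)$ is $\Delta$-decodable if for each of its $K$ symbols the corresponding unit row vector lies in the row space of the cumulative receiver matrix at time $t+\Delta$ (the generator rows of all encoded symbols that were delivered in the slots $1,\dots,t+\Delta$). Let $$p_e^{(\alpha)}=\lim_{T\to\infty}\lim_{q\to\infty}\frac1T\sum_{t=1}^T\Pr(\mathbf s(t)\text{ is not }\Delta\text{-decodable}),\qquad C_n=\frac1{n+1}\binom{2n}{n}.$$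 Then these limits exist for every $\alpha$, and the exact error probability for infinite memory, $p_e^{sys}=p_e^{(\infty)}=\lim_{\alpha\to\infty}p_e^{(\alpha)}$, is $$p_e^{sys}=\frac{\displaystyle\sum_{l=\lceil\Delta/2\rceil+1}^\infty p^l(1-p)^l\Big[(2l-\Delta-1)\,C_{l-1}-\sum_{i=0}^{\,l-\lceil\Delta/2\rceil-2}C_i\,C_{l-2-i}\,(2l-\Delta-3-2i)\Big]}{\displaystyle p+2p(1-p)\int_0^1\Big(1+\frac1{1-2\sqrt{p(1-p)}\cos\pi x}\Big)\frac{\sin^2\pi x}{1-2\sqrt{p(1-p)}\cos\pi x}\,dx},$$ where the series in the numerator converges, the denominator is positive, and empty sums are $0$. -/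

import Mathlib

open MeasureTheory ProbabilityTheory Filter
open scoped Topology

noncomputable section

/-- The finite field with `2 ^ q` elements carries the discrete σ-algebra. -/
instance instMeasurableSpaceGF (q : ℕ) : MeasurableSpace (GaloisField 2 q) := ⊤

/-- The cumulative generator matrix of the systematic random linear streaming code with memory `α`
(`α = ⊤`: all past source symbols are kept). Rows are indexed by the encoded symbols
`x_i(τ)`, written `(τ, i)`, and columns by the source symbols `s_j(s)`, written `(s, j)`;
timeslots start at `1`, and `i`, `j` are counted from `0`. The first `K` encoded symbols of a slot
are the source symbols of that slot. Each other one is the linear combination of the source symbols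
of the slots `max (τ - α) 1, …, τ` whose coefficients are given by `c`. -/
def cumulativeGenerator (K N : ℕ) (α : ℕ∞) {F : Type*} [Field F]
    (c : (ℕ × Fin N) × (ℕ × Fin K) → F) : Matrix (ℕ × Fin N) (ℕ × Fin K) F :=
  fun r v =>
    if (r.2 : ℕ) < K then
      (if v.1 = r.1 ∧ (v.2 : ℕ) = (r.2 : ℕ) then 1 else 0)
    else
      (if 1 ≤ v.1 ∧ v.1 ≤ r.1 ∧ (r.1 : ℕ∞) ≤ (v.1 : ℕ∞) + α then c (r, v) else 0)

/-- The row space of the cumulative receiver matrix at time `n`: the span of the rows of the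
generator matrix that belong to the packets of the slots `1, …, n` which are not erased.
`e τ = true` means that the packet of slot `τ` is erased. (The columns of slots after `n` vanish
on all these rows.) -/
def receiverRowSpace (K N : ℕ) (α : ℕ∞) {F : Type*} [Field F]
    (c : (ℕ × Fin N) × (ℕ × Fin K) → F) (e : ℕ → Bool) (n : ℕ) :
    Submodule F (ℕ × Fin K → F) :=
  Submodule.span F
    ((cumulativeGenerator K N α c).row '' {r | 1 ≤ r.1 ∧ r.1 ≤ n ∧ e r.1 = false})

/-- The source vector `s(t)` is `Δ`-decodable: for each of its `K` symbols the corresponding unit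
row vector is in the row space of the cumulative receiver matrix at time `t + Δ`. -/
def IsDecodable (K N : ℕ) (α : ℕ∞) (Δ : ℕ) {F : Type*} [Field F]
    (c : (ℕ × Fin N) × (ℕ × Fin K) → F) (e : ℕ → Bool) (t : ℕ) : Prop :=
  ∀ k : Fin K, (Pi.single (t, k) 1 : ℕ × Fin K → F) ∈ receiverRowSpace K N α c e (t + Δ)

/-- The i.i.d. packet erasure channel: independently in every slot the packet is delivered
(`false`) with probability `p` and erased (`true`) with probability `1 - p`. -/
def channelMeasure (p : unitInterval) : Measure (ℕ → Bool) :=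
  Measure.infinitePi (fun _ : ℕ => bernoulliMeasure false true p)

/-- The random coefficients: independent and uniform on the nonzero elements of `GF(2 ^ q)`. -/
def coeffMeasure (K N q : ℕ) : Measure ((ℕ × Fin N) × (ℕ × Fin K) → GaloisField 2 q) :=
  Measure.infinitePi (fun _ => uniformOn ({0}ᶜ : Set (GaloisField 2 q)))

instance instIsProbabilityMeasureChannel (p : unitInterval) :
    IsProbabilityMeasure (channelMeasure p) := by
  unfold channelMeasure
  infer_instance

instance instIsProbabilityMeasureCoeff (K N q : ℕ) :
    IsProbabilityMeasure (coeffMeasure K N q) := by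
  have h : IsProbabilityMeasure (uniformOn ({0}ᶜ : Set (GaloisField 2 q))) :=
    isProbabilityMeasure_uniformOn' (Set.toFinite _) ⟨1, by simp⟩
      MeasurableSpace.measurableSet_top
  unfold coeffMeasure
  infer_instance

/-- The probability that `s(t)` is not `Δ`-decodable, for the code over `GF(2 ^ q)`; the channel
and the coefficients are independent. -/
def slotErrorProb (K N : ℕ) (α : ℕ∞) (Δ : ℕ) (p : unitInterval) (q t : ℕ) : ℝ :=
  ((channelMeasure p).prod (coeffMeasure K N q)).real
    {ω | ¬ IsDecodable K N α Δ ω.2 ω.1 t}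

/-- The slot error probability averaged over the slots `1, …, T`, for the code over
`GF(2 ^ q)`. -/
def avgErrorProb (K N : ℕ) (α : ℕ∞) (Δ : ℕ) (p : unitInterval) (q T : ℕ) : ℝ :=
  1 / (T : ℝ) * ∑ t ∈ Finset.Icc 1 T, slotErrorProb K N α Δ p q t

/-- `x` is the long-term slot error probability in the large field size regime: the iterated limit,
first as `q → ∞` for every horizon `T`, then as `T → ∞`, exists and equals `x`. -/
def IsLongTermErrorProb (K N : ℕ) (α : ℕ∞) (Δ : ℕ) (p : unitInterval) (x : ℝ) : Prop :=
  ∃ a : ℕ → ℝ,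
    (∀ T, Tendsto (fun q => avgErrorProb K N α Δ p q T) atTop (𝓝 (a T))) ∧
      Tendsto a atTop (𝓝 x)

/-- The `l`-th term of the series in the numerator, for `l ≥ ⌈Δ / 2⌉ + 1`. The inner sum runs over
`0 ≤ i ≤ l - ⌈Δ / 2⌉ - 2`, and `⌈Δ / 2⌉` is written `(Δ + 1) / 2`. -/
def numeratorTerm (Δ : ℕ) (p : ℝ) (l : ℕ) : ℝ :=
  p ^ l * (1 - p) ^ l *
    ((2 * (l : ℝ) - Δ - 1) * (catalan (l - 1) : ℝ) -
      ∑ i ∈ Finset.range (l - (Δ + 1) / 2 - 1),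
        (catalan i : ℝ) * (catalan (l - 2 - i) : ℝ) * (2 * (l : ℝ) - Δ - 3 - 2 * (i : ℝ)))

/-- The numerator: the sum of the terms over all `l ≥ ⌈Δ / 2⌉ + 1`. -/
def numeratorSeries (Δ : ℕ) (p : ℝ) : ℝ :=
  ∑' m : ℕ, numeratorTerm Δ p ((Δ + 1) / 2 + 1 + m)

/-- The denominator. -/
def denominatorValue (p : ℝ) : ℝ :=
  p + 2 * p * (1 - p) *
    ∫ x in (0 : ℝ)..1,
      (1 + 1 / (1 - 2 * Real.sqrt (p * (1 - p)) * Real.cos (Real.pi * x))) *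
        (Real.sin (Real.pi * x) ^ 2 /
          (1 - 2 * Real.sqrt (p * (1 - p)) * Real.cos (Real.pi * x)))

end

noncomputable section

/-! ### Catalan sums -/

/-! At rate 1/2 a delivered packet has `K` parity symbols, as many equations as an erased source
vector has unknowns. For generic coefficients only counting matters. Let the information debt rise
by one at an erasure and fall by one, not below 0, at a delivery. With unlimited memory, `s(t)` is
lost exactly if slot `t` is erased and the debt is positive throughout the slots `t, …, t + Δ`
(`not_isGenericallyDecodable_top_iff`). Each direction matches erased slots with delivered ones. The
matching selects a square block of independent variables and zeros, and setting the matched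
variables to 1 and the others to 0 turns the block into the identity, so its determinant is a
nonzero polynomial (`det_generic_ne_zero`).

For a fixed slot, decodability over any specialization agrees with generic decodability off the zero
set of one nonzero polynomial, and by Schwartz-Zippel that set is negligible as `q → ∞`
(`tendsto_slotErrorProb`). Forgetting the first slot shows that the generic error probability is
nondecreasing in `t`. So it converges for every memory, and Cesàro means give the long-term limit.

The debt is a reflected walk with downward drift, whose tails tend to `r ^ k` with `r = (1 - p) /
p`. Hence the limit for unlimited memory is `(1 - p) (1 - r) ∑ r ^ k s(k + 1)`, where `s` is the
probability of staying positive for `Δ` steps. First passage times are Catalan distributed, and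
stationarity of the geometric weights turns the sum into a Catalan sum, `excessSum`
(`tsum_pow_mul_survivalProb`). The numerator is `p * excessSum`: its inner sums form a convolution
with a sequence of total mass `1 - p`. The denominator is `p / (2 p - 1) = 1 / (1 - r)`, the
reciprocal of the equilibrium probability of debt zero.

A finite memory `α > Δ` gives an error probability at most that of unlimited memory, with equality
in the slots with `t + Δ ≤ α`. Monotonicity in `t` then squeezes the limits as `α → ∞`. -/

theorem catalan_le_four_pow (n : ℕ) : catalan n ≤ 4 ^ n := by
  rw [catalan_eq_centralBinom_div]
  exact (Nat.div_le_self _ _).trans (Nat.centralBinom_le_four_pow n)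

theorem four_mul_mul_one_sub_lt_one {p : ℝ} (hp : 1 / 2 < p) : 4 * (p * (1 - p)) < 1 := by
  nlinarith [mul_pos (sub_pos.2 hp) (sub_pos.2 hp)]

theorem summable_natCast_mul_catalan_mul_pow {x : ℝ} (h0 : 0 ≤ x) (h1 : 4 * x < 1) (k : ℕ) :
    Summable fun n : ℕ => (n : ℝ) ^ k * ((catalan n : ℝ) * x ^ n) := by
  have hs := summable_pow_mul_geometric_of_norm_lt_one k (r := 4 * x)
    (by rwa [Real.norm_of_nonneg (by positivity)])
  refine hs.of_nonneg_of_le (fun n => by positivity) fun n => ?_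
  rw [mul_pow]
  have : (catalan n : ℝ) ≤ 4 ^ n := by exact_mod_cast catalan_le_four_pow n
  gcongr

theorem summable_catalan_mul_pow {x : ℝ} (h0 : 0 ≤ x) (h1 : 4 * x < 1) :
    Summable fun n : ℕ => (catalan n : ℝ) * x ^ n := by
  simpa using summable_natCast_mul_catalan_mul_pow h0 h1 0

theorem sum_antidiagonal_catalan_mul_pow (x : ℝ) (n : ℕ) :
    ∑ ij ∈ Finset.HasAntidiagonal.antidiagonal n,
      ((catalan ij.1 : ℝ) * x ^ ij.1) * ((catalan ij.2 : ℝ) * x ^ ij.2) =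
      (catalan (n + 1) : ℝ) * x ^ n := by
  rw [catalan_succ']
  push_cast
  rw [Finset.sum_mul]
  refine Finset.sum_congr rfl fun ij hij => ?_
  rw [← Finset.HasAntidiagonal.mem_antidiagonal.1 hij]
  ring

theorem tsum_catalan_mul_pow_eq_one_add {x : ℝ} (h0 : 0 ≤ x) (h1 : 4 * x < 1) :
    ∑' n : ℕ, (catalan n : ℝ) * x ^ n = 1 + x * (∑' n : ℕ, (catalan n : ℝ) * x ^ n) ^ 2 := by
  have hs := summable_catalan_mul_pow h0 h1
  have hn : Summable fun n : ℕ => ‖(catalan n : ℝ) * x ^ n‖ := hs.norm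
  rw [sq, tsum_mul_tsum_eq_tsum_sum_antidiagonal_of_summable_norm hn hn]
  simp_rw [sum_antidiagonal_catalan_mul_pow]
  rw [hs.tsum_eq_zero_add, ← tsum_mul_left]
  simp only [catalan_zero, Nat.cast_one, pow_zero, mul_one]
  congr 1
  refine tsum_congr fun n => ?_
  ring

/-- The Catalan recursion gives `S (n + 1) ≤ 1 + x * S n ^ 2` for the partial sums, and `1 / p` is a
fixed point of the right-hand side. This later selects the smaller of the two roots `1 / p` and `1 /
(1 - p)`. -/
theorem sum_range_catalan_mul_pow_le {p : ℝ} (h0 : 1 / 2 < p) (h1 : p ≤ 1) (n : ℕ) :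
    ∑ i ∈ Finset.range n, (catalan i : ℝ) * (p * (1 - p)) ^ i ≤ 1 / p := by
  have hp : 0 < p := by linarith
  have hx : 0 ≤ p * (1 - p) := mul_nonneg hp.le (by linarith)
  induction n with
  | zero => simp; exact hp.le
  | succ n ih =>
    have key : ∑ i ∈ Finset.range n, (catalan (i + 1) : ℝ) * (p * (1 - p)) ^ i ≤
        (∑ i ∈ Finset.range n, (catalan i : ℝ) * (p * (1 - p)) ^ i) ^ 2 := by
      -- The pairs with `i + j < n` form part of the square `i, j < n`, and all terms are
      -- nonnegative.
      rw [sq, Finset.sum_mul_sum, ← Finset.sum_product']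
      simp_rw [← sum_antidiagonal_catalan_mul_pow]
      rw [Finset.sum_sigma']
      refine (Finset.sum_bij_ne_zero (fun a _ _ => a.2) (t := (((Finset.range n).sigma
        fun i => Finset.HasAntidiagonal.antidiagonal i).image fun a => a.2)) ?_ ?_ ?_ ?_).trans_le
        (Finset.sum_le_sum_of_subset_of_nonneg ?_ ?_)
      · exact fun a ha _ => Finset.mem_image_of_mem _ ha
      · rintro ⟨i, a⟩ ha _ ⟨j, b⟩ hb _ hab
        simp only [Finset.mem_sigma, Finset.HasAntidiagonal.mem_antidiagonal] at ha hb hab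
        subst hab
        obtain rfl : i = j := by omega
        rfl
      · intro b hb hne
        obtain ⟨a, ha, rfl⟩ := Finset.mem_image.1 hb
        exact ⟨a, ha, hne, rfl⟩
      · exact fun _ _ _ => rfl
      · intro b hb
        obtain ⟨a, ha, rfl⟩ := Finset.mem_image.1 hb
        simp only [Finset.mem_sigma, Finset.HasAntidiagonal.mem_antidiagonal,
          Finset.mem_range] at ha
        simp only [Finset.mem_product, Finset.mem_range]
        omega
      · intro a _ _
        positivity
    rw [Finset.sum_range_succ']
    have e : ∑ i ∈ Finset.range n, (catalan (i + 1) : ℝ) * (p * (1 - p)) ^ (i + 1) =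
        p * (1 - p) * ∑ i ∈ Finset.range n, (catalan (i + 1) : ℝ) * (p * (1 - p)) ^ i := by
      rw [Finset.mul_sum]
      exact Finset.sum_congr rfl fun i _ => by ring
    have hS : 0 ≤ ∑ i ∈ Finset.range n, (catalan i : ℝ) * (p * (1 - p)) ^ i :=
      Finset.sum_nonneg fun i _ => by positivity
    have h2 := pow_le_pow_left₀ hS ih 2
    have h3 := mul_le_mul_of_nonneg_left (key.trans h2) hx
    rw [e]
    simp only [catalan_zero, Nat.cast_one, pow_zero, mul_one]
    have h4 : p * (1 - p) * (1 / p) ^ 2 + 1 = 1 / p := by field_simp; ring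
    linarith

/-- The value `1 / p` of the Catalan generating function at `p (1 - p)`, for `p > 1 / 2`. -/
theorem tsum_catalan_mul_pow {p : ℝ} (h0 : 1 / 2 < p) (h1 : p ≤ 1) :
    ∑' n : ℕ, (catalan n : ℝ) * (p * (1 - p)) ^ n = 1 / p := by
  have hp : 0 < p := by linarith
  have hx : 0 ≤ p * (1 - p) := mul_nonneg hp.le (by linarith)
  have hle : ∑' n : ℕ, (catalan n : ℝ) * (p * (1 - p)) ^ n ≤ 1 / p :=
    Real.tsum_le_of_sum_range_le (fun n => by positivity)
      (sum_range_catalan_mul_pow_le h0 h1)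
  have heq := tsum_catalan_mul_pow_eq_one_add hx (four_mul_mul_one_sub_lt_one h0)
  set c := ∑' n : ℕ, (catalan n : ℝ) * (p * (1 - p)) ^ n
  have hc : c * p ≤ 1 := by rwa [le_div_iff₀ hp] at hle
  have hf : (p * c - 1) * ((1 - p) * c - 1) = 0 := by linarith
  -- The other root is excluded: `(1 - p) * c < p * c ≤ 1`, because `1 - p < p` and `c > 0`.
  have hne : (1 - p) * c - 1 ≠ 0 := by
    intro h
    have hc0 : 0 < c := by
      by_contra hcn
      nlinarith
    nlinarith
  have := (mul_eq_zero.1 hf).resolve_right hne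
  rw [eq_div_iff hp.ne']
  linarith

/-- Applying `x d/dx` to `c = 1 + x c ^ 2` gives `d = x (2 d c + c ^ 2)`, which is linear in `d`;
with `c = 1 / p` the coefficient `1 - 2 x c` is `2 p - 1`. The derivative is replaced by a
symmetrized Cauchy product. -/
theorem tsum_natCast_mul_catalan_mul_pow {p : ℝ} (h0 : 1 / 2 < p) (h1 : p ≤ 1) :
    ∑' n : ℕ, (n : ℝ) * ((catalan n : ℝ) * (p * (1 - p)) ^ n) =
      (1 - p) / p / (2 * p - 1) := by
  have hp : 0 < p := by linarith
  have hx : 0 ≤ p * (1 - p) := mul_nonneg hp.le (by linarith)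
  have hx4 := four_mul_mul_one_sub_lt_one h0
  have hs := summable_catalan_mul_pow hx hx4
  have hs1 : Summable fun n : ℕ => (n : ℝ) * ((catalan n : ℝ) * (p * (1 - p)) ^ n) := by
    simpa using summable_natCast_mul_catalan_mul_pow hx hx4 1
  have hc := tsum_catalan_mul_pow h0 h1
  set x := p * (1 - p) with hxdef
  have hrec : ∑' n : ℕ, (n : ℝ) * ((catalan n : ℝ) * x ^ n) =
      x * (2 * ((∑' n : ℕ, (n : ℝ) * ((catalan n : ℝ) * x ^ n)) *
        ∑' n : ℕ, (catalan n : ℝ) * x ^ n) +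
        (∑' n : ℕ, (catalan n : ℝ) * x ^ n) * ∑' n : ℕ, (catalan n : ℝ) * x ^ n) := by
    have e1 := tsum_mul_tsum_eq_tsum_sum_antidiagonal_of_summable_norm hs1.norm hs.norm
    have e2 := tsum_mul_tsum_eq_tsum_sum_antidiagonal_of_summable_norm hs.norm hs.norm
    have s1 := (summable_norm_sum_mul_antidiagonal_of_summable_norm hs1.norm hs.norm).of_norm
    have s2 := (summable_norm_sum_mul_antidiagonal_of_summable_norm hs.norm hs.norm).of_norm
    rw [e1, e2, ← tsum_mul_left, ← (s1.mul_left 2).tsum_add s2, ← tsum_mul_left,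
      hs1.tsum_eq_zero_add]
    simp only [Nat.cast_zero, zero_mul, zero_add]
    refine tsum_congr fun n => ?_
    have hsym : ∑ ij ∈ Finset.HasAntidiagonal.antidiagonal n,
        (ij.1 : ℝ) * ((catalan ij.1 : ℝ) * x ^ ij.1) *
        ((catalan ij.2 : ℝ) * x ^ ij.2) = ∑ ij ∈ Finset.HasAntidiagonal.antidiagonal n,
        (ij.2 : ℝ) * ((catalan ij.1 : ℝ) * x ^ ij.1) * ((catalan ij.2 : ℝ) * x ^ ij.2) := by
      rw [← Finset.Nat.sum_antidiagonal_swap]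
      exact Finset.sum_congr rfl fun ij _ => by simp only [Prod.fst_swap, Prod.snd_swap]; ring
    rw [two_mul]
    nth_rw 2 [hsym]
    rw [← Finset.sum_add_distrib]
    have : ∑ ij ∈ Finset.HasAntidiagonal.antidiagonal n,
        ((ij.1 : ℝ) * ((catalan ij.1 : ℝ) * x ^ ij.1) * ((catalan ij.2 : ℝ) * x ^ ij.2) +
          (ij.2 : ℝ) * ((catalan ij.1 : ℝ) * x ^ ij.1) * ((catalan ij.2 : ℝ) * x ^ ij.2)) =
        (n : ℝ) * ∑ ij ∈ Finset.HasAntidiagonal.antidiagonal n,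
          ((catalan ij.1 : ℝ) * x ^ ij.1) * ((catalan ij.2 : ℝ) * x ^ ij.2) := by
      rw [Finset.mul_sum]
      refine Finset.sum_congr rfl fun ij hij => ?_
      rw [← Finset.HasAntidiagonal.mem_antidiagonal.1 hij]
      push_cast
      ring
    rw [this, sum_antidiagonal_catalan_mul_pow]
    push_cast
    ring
  rw [hc] at hrec
  set d := ∑' n : ℕ, (n : ℝ) * ((catalan n : ℝ) * x ^ n)
  have h2 : (2 * p - 1) ≠ 0 := by linarith
  rw [hxdef] at hrec
  rw [div_div, eq_div_iff (mul_ne_zero hp.ne' h2)]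
  field_simp at hrec
  linarith

/-! ### First passage and survival of the simple walk -/

/-- The probability that the walk that steps up with probability `1 - p` and down with probability
`p`, started at `k`, is at `0` for the first time after exactly `n` steps. -/
def firstPassageProb (p : ℝ) : ℕ → ℕ → ℝ
  | 0, 0 => 1
  | 0, _ + 1 => 0
  | _ + 1, 0 => 0
  | n + 1, k + 1 => (1 - p) * firstPassageProb p n (k + 2) + p * firstPassageProb p n k

/-- The probability that the walk that steps up with probability `1 - p` and down with probability
`p`, started at `k`, stays positive for `n` steps. -/
def survivalProb (p : ℝ) : ℕ → ℕ → ℝ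
  | _, 0 => 0
  | 0, _ + 1 => 1
  | n + 1, k + 1 => (1 - p) * survivalProb p n (k + 2) + p * survivalProb p n k

@[simp] theorem survivalProb_zero_right (p : ℝ) (n : ℕ) : survivalProb p n 0 = 0 := by
  cases n <;> rfl

theorem survivalProb_nonneg {p : ℝ} (h0 : 0 ≤ p) (h1 : p ≤ 1) (n k : ℕ) :
    0 ≤ survivalProb p n k := by
  induction n generalizing k with
  | zero => cases k <;> simp [survivalProb]
  | succ n ih =>
    cases k with
    | zero => simp
    | succ k =>
      simp only [survivalProb]
      exact add_nonneg (mul_nonneg (by linarith) (ih _)) (mul_nonneg h0 (ih _))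

theorem survivalProb_le_one {p : ℝ} (h0 : 0 ≤ p) (h1 : p ≤ 1) (n k : ℕ) :
    survivalProb p n k ≤ 1 := by
  induction n generalizing k with
  | zero => cases k <;> simp [survivalProb]
  | succ n ih =>
    cases k with
    | zero => simp
    | succ k =>
      simp only [survivalProb]
      have a := mul_le_mul_of_nonneg_left (ih (k + 2)) (by linarith : 0 ≤ 1 - p)
      have b := mul_le_mul_of_nonneg_left (ih k) h0
      linarith

theorem survivalProb_eq_one_sub_sum (p : ℝ) (n k : ℕ) :
    survivalProb p n k = 1 - ∑ m ∈ Finset.range (n + 1), firstPassageProb p m k := by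
  induction n generalizing k with
  | zero => cases k <;> simp [survivalProb, firstPassageProb]
  | succ n ih =>
    rw [Finset.sum_range_succ']
    cases k with
    | zero => simp [firstPassageProb]
    | succ k =>
      simp only [survivalProb, firstPassageProb, ih, Finset.sum_add_distrib, ← Finset.mul_sum]
      ring

open PowerSeries in
/-- The generating function of the first passage time from `1` to `0`. -/
def firstPassageSeries (p : ℝ) : PowerSeries ℝ :=
  C p * X * expand 2 two_ne_zero
    (rescale (p * (1 - p)) (catalanSeries.map (Nat.castRingHom ℝ)))

open PowerSeries in
theorem firstPassageSeries_eq (p : ℝ) :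
    firstPassageSeries p = C p * X + C (1 - p) * X * firstPassageSeries p ^ 2 := by
  have h := congrArg (fun f => expand 2 two_ne_zero
    (rescale (p * (1 - p)) (f.map (Nat.castRingHom ℝ)))) catalanSeries_sq_mul_X_add_one
  simp only [map_add, map_mul, map_pow, map_X, map_one, rescale_X, expand_X, expand_C] at h
  unfold firstPassageSeries
  set c := expand 2 two_ne_zero
    (rescale (p * (1 - p)) (catalanSeries.map (Nat.castRingHom ℝ)))
  conv_lhs => rw [← h]
  ring

-- To reach 0 from `k` the walk must descend one level `k` times, so the generating function is a
-- `k`-th power. The functional equation of `firstPassageSeries` is the one-step recursion.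
open PowerSeries in
theorem firstPassageProb_eq_coeff (p : ℝ) (n k : ℕ) :
    firstPassageProb p n k = coeff n (firstPassageSeries p ^ k) := by
  induction n generalizing k with
  | zero =>
    cases k with
    | zero => simp [firstPassageProb]
    | succ k =>
      have : constantCoeff (firstPassageSeries p) = 0 := by simp [firstPassageSeries]
      simp [firstPassageProb, this]
  | succ n ih =>
    cases k with
    | zero => simp [firstPassageProb, coeff_one]
    | succ k =>
      have : firstPassageSeries p ^ (k + 1) =
          (C p * firstPassageSeries p ^ k + C (1 - p) * firstPassageSeries p ^ (k + 2)) * X := by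
        rw [pow_succ]
        nth_rw 2 [firstPassageSeries_eq]
        ring
      rw [this, coeff_succ_mul_X, map_add, coeff_C_mul, coeff_C_mul, ← ih, ← ih]
      simp only [firstPassageProb]
      ring

open PowerSeries in
theorem firstPassageProb_odd_one (p : ℝ) (m : ℕ) :
    firstPassageProb p (2 * m + 1) 1 = p * ((catalan m : ℝ) * (p * (1 - p)) ^ m) := by
  rw [firstPassageProb_eq_coeff, pow_one, firstPassageSeries, mul_assoc, coeff_C_mul,
    mul_comm X, coeff_succ_mul_X, coeff_expand_mul, coeff_rescale, coeff_map,
    catalanSeries_coeff, Nat.coe_castRingHom]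
  ring

open PowerSeries in
theorem firstPassageProb_even_one (p : ℝ) (m : ℕ) : firstPassageProb p (2 * m) 1 = 0 := by
  rw [firstPassageProb_eq_coeff, pow_one, firstPassageSeries, mul_assoc, coeff_C_mul,
    mul_comm X]
  cases m with
  | zero => rw [mul_zero, coeff_zero_mul_X, mul_zero]
  | succ m =>
    rw [show 2 * (m + 1) = (2 * m + 1) + 1 by ring, coeff_succ_mul_X, coeff_expand_of_not_dvd _ _ _
      (by omega), mul_zero]

/-! ### The expected survival in equilibrium -/

theorem one_sub_div_lt_one {p : ℝ} (h0 : 1 / 2 < p) : (1 - p) / p < 1 := by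
  rw [div_lt_one (by linarith)]
  linarith

theorem one_sub_div_nonneg {p : ℝ} (h0 : 0 ≤ p) (h1 : p ≤ 1) : 0 ≤ (1 - p) / p :=
  div_nonneg (by linarith) h0

theorem sum_range_firstPassageProb_one (p : ℝ) (n : ℕ) :
    ∑ m ∈ Finset.range (n + 1), firstPassageProb p m 1 =
      ∑ m ∈ Finset.range ((n + 1) / 2), p * ((catalan m : ℝ) * (p * (1 - p)) ^ m) := by
  induction n with
  | zero => simp [firstPassageProb]
  | succ n ih =>
    rw [Finset.sum_range_succ, ih]
    rcases Nat.even_or_odd' n with ⟨m, rfl | rfl⟩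
    · rw [firstPassageProb_odd_one, show (2 * m + 1 + 1) / 2 = m + 1 by omega,
        show (2 * m + 1) / 2 = m by omega, Finset.sum_range_succ]
    · rw [show 2 * m + 1 + 1 = 2 * (m + 1) by ring, firstPassageProb_even_one, add_zero,
        show (2 * (m + 1) + 1) / 2 = 2 * (m + 1) / 2 by omega]

/-- Since `p > 1 / 2` the passage to 0 has total probability `p * (1 / p) = 1`, so survival is the
tail of the passage time, which takes the odd values `2 m + 1`. -/
theorem survivalProb_one {p : ℝ} (h0 : 1 / 2 < p) (h1 : p ≤ 1) (n : ℕ) :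
    survivalProb p n 1 =
      p * ∑' m : ℕ, if n < 2 * m + 1 then (catalan m : ℝ) * (p * (1 - p)) ^ m else 0 := by
  have hp : 0 < p := by linarith
  have hx : 0 ≤ p * (1 - p) := mul_nonneg hp.le (by linarith)
  have hs := summable_catalan_mul_pow hx (four_mul_mul_one_sub_lt_one h0)
  have hi : Summable fun m : ℕ =>
      if n < 2 * m + 1 then (catalan m : ℝ) * (p * (1 - p)) ^ m else 0 :=
    hs.of_nonneg_of_le (fun m => by split_ifs <;> positivity)
      fun m => by split_ifs <;> first | exact le_rfl | positivity
  have h := hs.sum_add_tsum_nat_add ((n + 1) / 2)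
  rw [tsum_catalan_mul_pow h0 h1] at h
  have h' := hi.sum_add_tsum_nat_add ((n + 1) / 2)
  rw [Finset.sum_eq_zero, zero_add] at h'
  · rw [survivalProb_eq_one_sub_sum, sum_range_firstPassageProb_one, ← Finset.mul_sum, ← h']
    have : ∀ m : ℕ, n < 2 * (m + (n + 1) / 2) + 1 := fun m => by omega
    simp only [this, if_true]
    have h2 := congrArg (p * ·) h
    simp only [mul_add, mul_one_div_cancel hp.ne'] at h2
    linarith
  · intro m hm
    rw [Finset.mem_range] at hm
    rw [if_neg (by omega)]

/-- The weighted Catalan sum `∑ (2 m + 1 - n)⁺ C_m (p (1 - p)) ^ (m + 1)`. -/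
def excessSum (p : ℝ) (n : ℕ) : ℝ :=
  ∑' m : ℕ, ((2 * m + 1 - n : ℕ) : ℝ) * ((catalan m : ℝ) * (p * (1 - p)) ^ (m + 1))

theorem summable_excessSum {p : ℝ} (h0 : 1 / 2 < p) (h1 : p ≤ 1) (n : ℕ) :
    Summable fun m : ℕ =>
      ((2 * m + 1 - n : ℕ) : ℝ) * ((catalan m : ℝ) * (p * (1 - p)) ^ (m + 1)) := by
  have hp : 0 < p := by linarith
  have hx : 0 ≤ p * (1 - p) := mul_nonneg hp.le (by linarith)
  have hx4 := four_mul_mul_one_sub_lt_one h0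
  have hs := ((summable_natCast_mul_catalan_mul_pow hx hx4 1).mul_left 2).add
    (summable_catalan_mul_pow hx hx4)
  refine (hs.mul_right (p * (1 - p))).of_nonneg_of_le (fun m => by positivity) fun m => ?_
  have : ((2 * m + 1 - n : ℕ) : ℝ) ≤ 2 * m + 1 := by
    exact_mod_cast Nat.sub_le (2 * m + 1) n
  calc ((2 * m + 1 - n : ℕ) : ℝ) * ((catalan m : ℝ) * (p * (1 - p)) ^ (m + 1))
      ≤ (2 * m + 1) * ((catalan m : ℝ) * (p * (1 - p)) ^ (m + 1)) := by gcongr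
    _ = _ := by ring

theorem excessSum_zero {p : ℝ} (h0 : 1 / 2 < p) (h1 : p ≤ 1) :
    excessSum p 0 = (1 - p) / (2 * p - 1) := by
  have hp : 0 < p := by linarith
  have h2 : 2 * p - 1 ≠ 0 := by linarith
  have hx : 0 ≤ p * (1 - p) := mul_nonneg hp.le (by linarith)
  have hx4 := four_mul_mul_one_sub_lt_one h0
  have hs := summable_catalan_mul_pow hx hx4
  have hs1 : Summable fun n : ℕ => (n : ℝ) * ((catalan n : ℝ) * (p * (1 - p)) ^ n) := by
    simpa using summable_natCast_mul_catalan_mul_pow hx hx4 1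
  have : excessSum p 0 = p * (1 - p) *
      (2 * (∑' n : ℕ, (n : ℝ) * ((catalan n : ℝ) * (p * (1 - p)) ^ n)) +
        ∑' n : ℕ, (catalan n : ℝ) * (p * (1 - p)) ^ n) := by
    rw [← tsum_mul_left, ← (hs1.mul_left 2).tsum_add hs, ← tsum_mul_left, excessSum]
    refine tsum_congr fun m => ?_
    push_cast
    ring
  rw [this, tsum_natCast_mul_catalan_mul_pow h0 h1, tsum_catalan_mul_pow h0 h1]
  generalize hs : 2 * p - 1 = s at h2 ⊢
  field_simp
  linear_combination (p - 1) * hs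

/-- Raising `n` by one lowers the truncated weight by one exactly where `2 m + 1 > n`; these are the
terms of the tail in `survivalProb_one`. -/
theorem excessSum_succ {p : ℝ} (h0 : 1 / 2 < p) (h1 : p ≤ 1) (n : ℕ) :
    excessSum p (n + 1) = excessSum p n - (1 - p) * survivalProb p n 1 := by
  rw [survivalProb_one h0 h1, eq_sub_iff_add_eq, ← mul_assoc, ← tsum_mul_left, excessSum,
    excessSum, ← (summable_excessSum h0 h1 (n + 1)).tsum_add]
  · refine tsum_congr fun m => ?_
    split_ifs with h
    · have : ((2 * m + 1 - n : ℕ) : ℝ) = ((2 * m + 1 - (n + 1) : ℕ) : ℝ) + 1 := by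
        rw [← Nat.cast_succ]
        congr 1
        omega
      rw [this]
      ring
    · rw [show 2 * m + 1 - n = 0 by omega, show 2 * m + 1 - (n + 1) = 0 by omega]
      simp
  · have hp : 0 < p := by linarith
    have hx : 0 ≤ p * (1 - p) := mul_nonneg hp.le (by linarith)
    refine Summable.mul_left _ ((summable_catalan_mul_pow hx
      (four_mul_mul_one_sub_lt_one h0)).of_nonneg_of_le
        (fun m => by split_ifs <;> positivity)
        fun m => by split_ifs <;> first | exact le_rfl | positivity)

theorem summable_pow_mul_survivalProb {p : ℝ} (h0 : 1 / 2 < p) (h1 : p ≤ 1) (n : ℕ) (f : ℕ → ℕ) :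
    Summable fun k : ℕ => ((1 - p) / p) ^ k * survivalProb p n (f k) := by
  have hp : 0 ≤ p := by linarith
  have hr := one_sub_div_nonneg hp h1
  refine (summable_geometric_of_lt_one hr (one_sub_div_lt_one h0)).of_nonneg_of_le
    (fun k => mul_nonneg (by positivity) (survivalProb_nonneg hp h1 _ _)) fun k => ?_
  exact mul_le_of_le_one_right (by positivity) (survivalProb_le_one hp h1 _ _)

/-- The survival probability averaged over the geometric weights `((1 - p) / p) ^ k`. -/
theorem tsum_pow_mul_survivalProb {p : ℝ} (h0 : 1 / 2 < p) (h1 : p ≤ 1) (n : ℕ) :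
    (1 - p) / p * ∑' k : ℕ, ((1 - p) / p) ^ k * survivalProb p n (k + 1) = excessSum p n := by
  have hp : 0 < p := by linarith
  induction n with
  | zero =>
    simp only [survivalProb, mul_one]
    rw [tsum_geometric_of_lt_one (one_sub_div_nonneg hp.le h1) (one_sub_div_lt_one h0),
      excessSum_zero h0 h1]
    have h2 : 2 * p - 1 ≠ 0 := by linarith
    have : 1 - (1 - p) / p = (2 * p - 1) / p := by field_simp; ring
    rw [this]
    field_simp
  | succ n ih =>
    rw [excessSum_succ h0 h1, ← ih]
    -- Detailed balance `p * r = 1 - p` lets the up-steps and down-steps cancel in the weighted sum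
    -- except at the boundary, so the left side also decreases by `(1 - p) * survivalProb p n 1`.
    set r := (1 - p) / p with hr
    have hpr : 1 - p = p * r := by rw [hr]; field_simp
    have s := summable_pow_mul_survivalProb h0 h1 n
    simp only [survivalProb, mul_add]
    have e1 : ∀ k : ℕ, r ^ k * ((1 - p) * survivalProb p n (k + 2)) =
        p * (r ^ (k + 1) * survivalProb p n (k + 1 + 1)) := fun k => by rw [hpr]; ring
    have e2 : ∀ k : ℕ, r ^ k * (p * survivalProb p n k) =
        p * (r ^ k * survivalProb p n k) := fun k => by ring
    simp only [e1, e2]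
    rw [Summable.tsum_add
      (((summable_nat_add_iff 1).2 (s (fun k => k + 1))).mul_left p)
      ((s (fun k => k)).mul_left p), tsum_mul_left, tsum_mul_left,
      (s (fun k => k)).tsum_eq_zero_add, (s (fun k => k + 1)).tsum_eq_zero_add]
    have e3 : ∑' k : ℕ, r ^ (k + 1) * survivalProb p n (k + 1) =
        r * ∑' k : ℕ, r ^ k * survivalProb p n (k + 1) := by
      rw [← tsum_mul_left]
      exact tsum_congr fun k => by ring
    rw [e3, (s (fun k => k + 1)).tsum_eq_zero_add]
    simp only [survivalProb_zero_right, pow_zero, mul_zero, zero_add, one_mul]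
    set A := ∑' k : ℕ, r ^ (k + 1) * survivalProb p n (k + 1 + 1)
    have : p * r = 1 - p := hpr.symm
    linear_combination r * (survivalProb p n 1 + A) * this - survivalProb p n 1 * this

/-! ### The numerator -/

theorem numeratorTerm_eq (Δ : ℕ) (p : ℝ) (m : ℕ) :
    numeratorTerm Δ p ((Δ + 1) / 2 + 1 + (m + 1)) =
      ((2 * (m + 1 + (Δ + 1) / 2) + 1 - Δ : ℕ) : ℝ) *
          ((catalan (m + 1 + (Δ + 1) / 2) : ℝ) * (p * (1 - p)) ^ (m + 1 + (Δ + 1) / 2 + 1)) -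
        ∑ ij ∈ Finset.HasAntidiagonal.antidiagonal (m + (Δ + 1) / 2),
          ((catalan ij.1 : ℝ) * (p * (1 - p)) ^ (ij.1 + 1)) *
            (((2 * ij.2 + 1 - Δ : ℕ) : ℝ) *
              ((catalan ij.2 : ℝ) * (p * (1 - p)) ^ (ij.2 + 1))) := by
  set L := (Δ + 1) / 2 with hL
  rw [Finset.Nat.sum_antidiagonal_eq_sum_range_succ_mk]
  have hsplit : ∑ k ∈ Finset.range (m + L).succ,
      ((catalan k : ℝ) * (p * (1 - p)) ^ (k + 1)) * (((2 * (m + L - k) + 1 - Δ : ℕ) : ℝ) *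
        ((catalan (m + L - k) : ℝ) * (p * (1 - p)) ^ (m + L - k + 1))) =
      ∑ k ∈ Finset.range (m + 1),
      ((catalan k : ℝ) * (p * (1 - p)) ^ (k + 1)) * (((2 * (m + L - k) + 1 - Δ : ℕ) : ℝ) *
        ((catalan (m + L - k) : ℝ) * (p * (1 - p)) ^ (m + L - k + 1))) := by
    symm
    -- For `k > m` the second index `m + L - k` lies below `L = ⌈Δ / 2⌉`, and the truncated weight
    -- vanishes.
    refine Finset.sum_subset (fun k hk => ?_) fun k hk hk' => ?_
    · rw [Finset.mem_range] at hk ⊢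
      omega
    · rw [Finset.mem_range] at hk hk'
      rw [show 2 * (m + L - k) + 1 - Δ = 0 by omega]
      simp
  simp only [hsplit]
  rw [numeratorTerm, ← hL, show L + 1 + (m + 1) - L - 1 = m + 1 by omega,
    show L + 1 + (m + 1) - 1 = m + 1 + L by omega, mul_sub, ← mul_pow, Finset.mul_sum]
  congr 1
  · rw [Nat.cast_sub (by omega)]
    push_cast
    ring
  · refine Finset.sum_congr rfl fun k hk => ?_
    rw [Finset.mem_range] at hk
    rw [Nat.cast_sub (by omega), show L + 1 + (m + 1) - 2 - k = m + L - k by omega]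
    push_cast
    rw [Nat.cast_sub (by omega)]
    have : (p * (1 - p)) ^ (L + 1 + (m + 1)) =
        (p * (1 - p)) ^ (k + 1) * (p * (1 - p)) ^ (m + L - k + 1) := by
      rw [← pow_add]
      congr 1
      omega
    rw [this]
    push_cast
    ring

theorem numeratorTerm_first (Δ : ℕ) (p : ℝ) :
    numeratorTerm Δ p ((Δ + 1) / 2 + 1 + 0) =
      ((2 * ((Δ + 1) / 2) + 1 - Δ : ℕ) : ℝ) *
        ((catalan ((Δ + 1) / 2) : ℝ) * (p * (1 - p)) ^ ((Δ + 1) / 2 + 1)) := by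
  set L := (Δ + 1) / 2 with hL
  rw [numeratorTerm, ← hL, show L + 1 + 0 - L - 1 = 0 by omega, Finset.range_zero,
    Finset.sum_empty, Nat.cast_sub (by omega), add_zero, Nat.add_sub_cancel, ← mul_pow]
  push_cast
  ring

/-- Put `A m` for the terms of `excessSum` and `B m = C_m x ^ (m + 1)` with `x = p (1 - p)`. The
series is `∑ A` minus the sum of the convolution `B * A`, and `∑ B = x / p = 1 - p`, which leaves
the factor `1 - (1 - p) = p`. Indices below `⌈Δ / 2⌉` contribute nothing because of the truncation.
-/
theorem hasSum_numeratorTerm (Δ : ℕ) {p : ℝ} (h0 : 1 / 2 < p) (h1 : p ≤ 1) :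
    HasSum (fun m : ℕ => numeratorTerm Δ p ((Δ + 1) / 2 + 1 + m)) (p * excessSum p Δ) := by
  have hp : 0 < p := by linarith
  have hx : 0 ≤ p * (1 - p) := mul_nonneg hp.le (by linarith)
  have hx4 := four_mul_mul_one_sub_lt_one h0
  have sA := summable_excessSum h0 h1 Δ
  have eB : ∀ m : ℕ, (catalan m : ℝ) * (p * (1 - p)) ^ (m + 1) =
      p * (1 - p) * ((catalan m : ℝ) * (p * (1 - p)) ^ m) := fun m => by ring
  have sB : Summable fun m : ℕ => (catalan m : ℝ) * (p * (1 - p)) ^ (m + 1) := by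
    simp only [eB]
    exact (summable_catalan_mul_pow hx hx4).mul_left _
  have tB : ∑' m : ℕ, (catalan m : ℝ) * (p * (1 - p)) ^ (m + 1) = 1 - p := by
    simp only [eB]
    rw [tsum_mul_left, tsum_catalan_mul_pow h0 h1]
    field_simp
  have sAB := (summable_norm_sum_mul_antidiagonal_of_summable_norm sB.norm sA.norm).of_norm
  have tAB := tsum_mul_tsum_eq_tsum_sum_antidiagonal_of_summable_norm sB.norm sA.norm
  rw [tB] at tAB
  set L := (Δ + 1) / 2 with hL
  have hA := (hasSum_nat_add_iff' L).2 sA.hasSum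
  have hAB := (hasSum_nat_add_iff' L).2 sAB.hasSum
  rw [Finset.sum_eq_zero, sub_zero] at hA hAB
  · rw [← hasSum_nat_add_iff' 1] at hA ⊢
    rw [← tAB] at hAB
    have := hA.sub hAB
    convert this using 1
    · ext m
      rw [numeratorTerm_eq]
    · have hf := numeratorTerm_first Δ p
      rw [← hL] at hf
      rw [Finset.sum_range_one, Finset.sum_range_one, hf, zero_add, excessSum]
      ring
  · intro m hm
    rw [Finset.mem_range] at hm
    refine Finset.sum_eq_zero fun ij hij => ?_
    have := Finset.HasAntidiagonal.mem_antidiagonal.1 hij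
    rw [show 2 * ij.2 + 1 - Δ = 0 by omega]
    simp
  · intro m hm
    rw [Finset.mem_range] at hm
    rw [show 2 * m + 1 - Δ = 0 by omega]
    simp

theorem numeratorSeries_eq (Δ : ℕ) {p : ℝ} (h0 : 1 / 2 < p) (h1 : p ≤ 1) :
    numeratorSeries Δ p = p * excessSum p Δ :=
  (hasSum_numeratorTerm Δ h0 h1).tsum_eq

/-! ### Convergence of the reflected walk to equilibrium -/

/-- The probability that the reflected walk that steps up with probability `1 - p` and down with
probability `p`, started at `0`, is at least `k` after `n` steps. -/
def reflectedTail (p : ℝ) : ℕ → ℕ → ℝ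
  | _, 0 => 1
  | 0, _ + 1 => 0
  | n + 1, k + 1 => (1 - p) * reflectedTail p n k + p * reflectedTail p n (k + 2)

@[simp] theorem reflectedTail_zero_right (p : ℝ) (n : ℕ) : reflectedTail p n 0 = 1 := by
  cases n <;> rfl

theorem reflectedTail_eq_zero_of_lt (p : ℝ) {n k : ℕ} (h : n < k) : reflectedTail p n k = 0 := by
  induction n generalizing k with
  | zero =>
    obtain ⟨k, rfl⟩ := Nat.exists_eq_succ_of_ne_zero h.ne'
    rfl
  | succ n ih =>
    obtain ⟨k, rfl⟩ := Nat.exists_eq_succ_of_ne_zero (by omega : k ≠ 0)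
    simp only [reflectedTail]
    rw [ih (by omega), ih (by omega)]
    ring

theorem reflectedTail_nonneg {p : ℝ} (h0 : 0 ≤ p) (h1 : p ≤ 1) (n k : ℕ) :
    0 ≤ reflectedTail p n k := by
  induction n generalizing k with
  | zero => cases k <;> simp [reflectedTail]
  | succ n ih =>
    cases k with
    | zero => simp
    | succ k =>
      simp only [reflectedTail]
      exact add_nonneg (mul_nonneg (by linarith) (ih _)) (mul_nonneg h0 (ih _))

/-- The geometric tail is invariant under the recursion and dominates the start at 0. -/
theorem reflectedTail_le_pow {p : ℝ} (h0 : 0 < p) (h1 : p ≤ 1) (n k : ℕ) :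
    reflectedTail p n k ≤ ((1 - p) / p) ^ k := by
  have hr := one_sub_div_nonneg h0.le h1
  induction n generalizing k with
  | zero => cases k <;> simp [reflectedTail]; positivity
  | succ n ih =>
    cases k with
    | zero => simp
    | succ k =>
      simp only [reflectedTail]
      calc (1 - p) * reflectedTail p n k + p * reflectedTail p n (k + 2)
          ≤ (1 - p) * ((1 - p) / p) ^ k + p * ((1 - p) / p) ^ (k + 2) :=
            add_le_add (mul_le_mul_of_nonneg_left (ih _) (by linarith))
              (mul_le_mul_of_nonneg_left (ih _) h0.le)
        _ = ((1 - p) / p) ^ (k + 1) := by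
          have : 1 - p = p * ((1 - p) / p) := by field_simp
          set r := (1 - p) / p
          linear_combination (r ^ k - r ^ (k + 1)) * this

theorem reflectedTail_le_succ {p : ℝ} (h0 : 0 ≤ p) (h1 : p ≤ 1) (n k : ℕ) :
    reflectedTail p n k ≤ reflectedTail p (n + 1) k := by
  induction n generalizing k with
  | zero =>
    cases k with
    | zero => simp
    | succ k => exact reflectedTail_nonneg h0 h1 1 (k + 1)
  | succ n ih =>
    cases k with
    | zero => simp
    | succ k =>
      rw [reflectedTail, reflectedTail]
      exact add_le_add (mul_le_mul_of_nonneg_left (ih _) (by linarith))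
        (mul_le_mul_of_nonneg_left (ih _) h0)

theorem reflectedTail_succ_le {p : ℝ} (h0 : 0 ≤ p) (h1 : p ≤ 1) (n k : ℕ) :
    reflectedTail p n (k + 1) ≤ reflectedTail p n k := by
  induction n generalizing k with
  | zero => cases k <;> simp [reflectedTail]
  | succ n ih =>
    cases k with
    | zero =>
      simp only [reflectedTail]
      have a := mul_le_mul_of_nonneg_left ((ih 1).trans (ih 0)) h0
      simp only [reflectedTail_zero_right, zero_add] at a ⊢
      norm_num at a ⊢
      linarith
    | succ k =>
      rw [reflectedTail, reflectedTail]
      exact add_le_add (mul_le_mul_of_nonneg_left (ih _) (by linarith))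
        (mul_le_mul_of_nonneg_left (ih _) h0)

/-- The tails increase with time and are bounded by `r ^ k`, so they have limits `D k`. The
recursion passes to the limit and makes the differences of `D` geometric with ratio `r`; then `D 0 =
1` and `D k → 0` force `D k = r ^ k`. -/
theorem tendsto_reflectedTail {p : ℝ} (h0 : 1 / 2 < p) (h1 : p ≤ 1) (k : ℕ) :
    Tendsto (fun n => reflectedTail p n k) atTop (𝓝 (((1 - p) / p) ^ k)) := by
  have hp : 0 < p := by linarith
  set r := (1 - p) / p with hr
  have hr0 : 0 ≤ r := one_sub_div_nonneg hp.le h1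
  have hr1 : r < 1 := one_sub_div_lt_one h0
  have hpr : 1 - p = p * r := by rw [hr]; field_simp
  have hlim : ∀ k, Tendsto (fun n => reflectedTail p n k) atTop (𝓝 (⨆ n, reflectedTail p n k)) :=
    fun k => tendsto_atTop_ciSup (monotone_nat_of_le_succ fun n => reflectedTail_le_succ hp.le h1 n k)
      ⟨r ^ k, by rintro _ ⟨n, rfl⟩; exact reflectedTail_le_pow hp h1 n k⟩
  have hex : ∀ k, ∃ d, Tendsto (fun n => reflectedTail p n k) atTop (𝓝 d) :=
    fun k => ⟨_, hlim k⟩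
  choose D hD using hex
  have hD0 : D 0 = 1 := by
    refine tendsto_nhds_unique (hD 0) ?_
    simp
  have hle : ∀ k, D k ≤ r ^ k := fun k =>
    le_of_tendsto' (hD k) fun n => reflectedTail_le_pow hp h1 n k
  have hge : ∀ k, 0 ≤ D k := fun k =>
    ge_of_tendsto' (hD k) fun n => reflectedTail_nonneg hp.le h1 n k
  have hrec : ∀ k, D (k + 1) = (1 - p) * D k + p * D (k + 2) := fun k =>
    tendsto_nhds_unique ((tendsto_add_atTop_iff_nat 1).2 (hD (k + 1)))
      (((hD k).const_mul (1 - p)).add ((hD (k + 2)).const_mul p))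
  have hdiff : ∀ k, D k - D (k + 1) = r ^ k * (D 0 - D 1) := by
    intro k
    induction k with
    | zero => simp
    | succ k ih =>
      have : p * (D (k + 1) - D (k + 1 + 1)) = p * (r ^ (k + 1) * (D 0 - D 1)) := by
        have e := hrec k
        rw [pow_succ]
        linear_combination p * r * ih + e + (D k - D (k + 1)) * hpr
      exact mul_left_cancel₀ hp.ne' this
  have hsum : ∀ k, (1 - r) * (1 - D k) = (1 - r ^ k) * (1 - D 1) := by
    intro k
    induction k with
    | zero => simp [hD0]
    | succ k ih =>
      have := hdiff k
      rw [hD0] at this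
      linear_combination ih + (1 - r) * this
  have hDlim : Tendsto D atTop (𝓝 0) :=
    squeeze_zero hge hle (tendsto_pow_atTop_nhds_zero_of_lt_one hr0 hr1)
  have h1r : 1 - r = 1 - D 1 := by
    have a : Tendsto (fun k => (1 - r) * (1 - D k)) atTop (𝓝 ((1 - r) * (1 - 0))) :=
      (hDlim.const_sub 1).const_mul (1 - r)
    have b := ((tendsto_pow_atTop_nhds_zero_of_lt_one hr0 hr1).const_sub 1).mul_const (1 - D 1)
    rw [funext hsum] at a
    simpa using tendsto_nhds_unique a b
  have hDk : D k = r ^ k := by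
    have e := hsum k
    rw [← h1r] at e
    have : (1 - r) * (D k - r ^ k) = 0 := by linarith
    have := (mul_eq_zero.1 this).resolve_left (by linarith)
    linarith
  rw [← hDk]
  exact hD k

/-- The equilibrium limit of the survival probability after an additional up step. -/
theorem tendsto_sum_reflectedTail_mul_survivalProb (Δ : ℕ) {p : ℝ} (h0 : 1 / 2 < p) (h1 : p ≤ 1) :
    Tendsto (fun t => (1 - p) * ∑ k ∈ Finset.range (t + 1),
      (reflectedTail p t k - reflectedTail p t (k + 1)) * survivalProb p Δ (k + 1)) atTop
      (𝓝 (numeratorSeries Δ p / (p / (2 * p - 1)))) := by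
  have hp : 0 < p := by linarith
  have h2 : 2 * p - 1 ≠ 0 := by linarith
  have hr0 := one_sub_div_nonneg hp.le h1
  have hr1 := one_sub_div_lt_one h0
  have hval : numeratorSeries Δ p / (p / (2 * p - 1)) =
      (1 - p) * ∑' k : ℕ, (((1 - p) / p) ^ k - ((1 - p) / p) ^ (k + 1)) *
        survivalProb p Δ (k + 1) := by
    rw [numeratorSeries_eq Δ h0 h1, ← tsum_pow_mul_survivalProb h0 h1]
    have : ∀ k : ℕ, (((1 - p) / p) ^ k - ((1 - p) / p) ^ (k + 1)) * survivalProb p Δ (k + 1) =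
        (1 - (1 - p) / p) * (((1 - p) / p) ^ k * survivalProb p Δ (k + 1)) := fun k => by ring
    simp only [this]
    rw [tsum_mul_left]
    field_simp
    ring
  rw [hval]
  refine Tendsto.const_mul _ ?_
  have heq : ∀ t : ℕ, ∑ k ∈ Finset.range (t + 1),
      (reflectedTail p t k - reflectedTail p t (k + 1)) * survivalProb p Δ (k + 1) =
      ∑' k : ℕ, (reflectedTail p t k - reflectedTail p t (k + 1)) * survivalProb p Δ (k + 1) := by
    intro t
    symm
    refine tsum_eq_sum fun k hk => ?_
    rw [Finset.mem_range, not_lt] at hk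
    rw [reflectedTail_eq_zero_of_lt p (by omega : t < k),
      reflectedTail_eq_zero_of_lt p (by omega : t < k + 1)]
    simp
  simp only [heq]
  -- The point probabilities at every time are dominated by the summable `r ^ k`.
  refine tendsto_tsum_of_dominated_convergence (bound := fun k => ((1 - p) / p) ^ k)
    (summable_geometric_of_lt_one hr0 hr1)
    (fun k => ((tendsto_reflectedTail h0 h1 k).sub (tendsto_reflectedTail h0 h1 (k + 1))).mul_const _)
    (Eventually.of_forall fun t k => ?_)
  have a := reflectedTail_succ_le hp.le h1 t k
  have b := reflectedTail_le_pow hp h1 t k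
  have c := reflectedTail_nonneg hp.le h1 t (k + 1)
  rw [norm_mul, Real.norm_of_nonneg (by linarith),
    Real.norm_of_nonneg (survivalProb_nonneg hp.le h1 _ _)]
  exact (mul_le_of_le_one_right (by linarith) (survivalProb_le_one hp.le h1 _ _)).trans
    (by linarith)

/-! ### The denominator -/

/-- The integral of the denominator, with `2 √(p (1 - p)) = 2 r / (1 + r ^ 2)`. -/
theorem integral_sin_sq_div_poisson {r : ℝ} (h0 : 0 < r) (h1 : r < 1) :
    ∫ x in (0 : ℝ)..1,
      (1 + 1 / (1 - 2 * r / (1 + r ^ 2) * Real.cos (Real.pi * x))) *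
        (Real.sin (Real.pi * x) ^ 2 / (1 - 2 * r / (1 + r ^ 2) * Real.cos (Real.pi * x))) =
      (1 + r ^ 2) / (1 - r ^ 2) := by
  have hr2 : (0 : ℝ) < 1 - r ^ 2 := by nlinarith
  have hP : ∀ θ : ℝ, 0 < 1 + r ^ 2 - 2 * r * Real.cos θ := fun θ => by
    nlinarith [Real.cos_le_one θ, mul_pos h0 (sub_pos.2 h1), sq_nonneg (1 - r),
      mul_pos (sub_pos.2 h1) (sub_pos.2 h1)]
  have hQ : ∀ θ : ℝ, 0 < 1 - r * Real.cos θ := fun θ => by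
    nlinarith [Real.cos_le_one θ]
  -- This is minus the argument of `1 - r e^{iθ}`. It has no branch jump because `1 - r cos θ > 0`,
  -- and `θ + 2 A θ` is an antiderivative of the Poisson kernel `(1 - r ^ 2) / (1 + r ^ 2 - 2 r cos
  -- θ)`.
  set A : ℝ → ℝ := fun θ => Real.arctan (r * Real.sin θ / (1 - r * Real.cos θ)) with hA
  have hAd : ∀ θ, HasDerivAt A
      ((r * Real.cos θ - r ^ 2) / (1 + r ^ 2 - 2 * r * Real.cos θ)) θ := by
    intro θ
    have hn : HasDerivAt (fun θ => r * Real.sin θ) (r * Real.cos θ) θ :=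
      (Real.hasDerivAt_sin θ).const_mul r
    have hd : HasDerivAt (fun θ => 1 - r * Real.cos θ) (r * Real.sin θ) θ := by
      simpa using ((Real.hasDerivAt_cos θ).const_mul r).const_sub 1
    refine (hn.div hd (hQ θ).ne').arctan.congr_deriv ?_
    have hq := (hQ θ).ne'
    have hp := (hP θ).ne'
    have hcs := Real.sin_sq_add_cos_sq θ
    have hden : (1 - r * Real.cos θ) ^ 2 + (r * Real.sin θ) ^ 2 =
        1 + r ^ 2 - 2 * r * Real.cos θ := by linear_combination r ^ 2 * hcs
    have e1 : 1 + (r * Real.sin θ / (1 - r * Real.cos θ)) ^ 2 =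
        (1 + r ^ 2 - 2 * r * Real.cos θ) / (1 - r * Real.cos θ) ^ 2 := by
      rw [← hden]
      field_simp
    rw [Pi.div_apply, e1]
    generalize 1 + r ^ 2 - 2 * r * Real.cos θ = P at hp ⊢
    field_simp
    linear_combination -r * hcs
  set M : ℝ := 1 + r ^ 2 with hM
  have hMpos : 0 < M := by positivity
  -- With `P = M - 2 r cos θ` the integrand is `M sin² / P + M² sin² / P²`. The first summand of `F`
  -- comes from dividing `sin²` by `P` as polynomials in `cos θ`, the second from integrating `sin²
  -- / P²` by parts and writing `cos / P = (M / P - 1) / (2 r)`.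
  set F : ℝ → ℝ := fun θ =>
    M / (4 * r ^ 2) * (-(1 - r ^ 2) * (θ + 2 * A θ) + M * θ + 2 * r * Real.sin θ) +
      M ^ 2 / (2 * r) * ((M / (1 - r ^ 2) * (θ + 2 * A θ) - θ) / (2 * r) -
        Real.sin θ / (M - 2 * r * Real.cos θ)) with hF
  have hFd : ∀ θ, HasDerivAt F (M * (Real.sin θ ^ 2 / (M - 2 * r * Real.cos θ)) +
      M ^ 2 * (Real.sin θ ^ 2 / (M - 2 * r * Real.cos θ) ^ 2)) θ := by
    intro θ
    have hp := (hP θ).ne'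
    have hB : HasDerivAt (fun θ => θ + 2 * A θ) ((1 - r ^ 2) / (M - 2 * r * Real.cos θ)) θ := by
      refine ((hasDerivAt_id θ).add ((hAd θ).const_mul 2)).congr_deriv ?_
      field_simp
      rw [hM]
      ring
    have hPd : HasDerivAt (fun θ => M - 2 * r * Real.cos θ) (2 * r * Real.sin θ) θ := by
      simpa using ((Real.hasDerivAt_cos θ).const_mul (2 * r)).const_sub M
    have h1 := (((hB.const_mul (-(1 - r ^ 2))).add ((hasDerivAt_id θ).const_mul M)).add
      ((Real.hasDerivAt_sin θ).const_mul (2 * r))).const_mul (M / (4 * r ^ 2))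
    have h2 := ((((hB.const_mul (M / (1 - r ^ 2))).sub (hasDerivAt_id θ)).div_const (2 * r)).sub
      ((Real.hasDerivAt_sin θ).div hPd hp)).const_mul (M ^ 2 / (2 * r))
    refine (h1.add h2).congr_deriv ?_
    have hs : Real.sin θ ^ 2 = 1 - Real.cos θ ^ 2 := by
      linear_combination Real.sin_sq_add_cos_sq θ
    have hs' : Real.sin θ * (2 * r * Real.sin θ) = 2 * r * (1 - Real.cos θ ^ 2) := by
      rw [← hs]; ring
    rw [hs', hs]
    have hr' := hr2.ne'
    generalize Real.cos θ = c at hp ⊢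
    have hc : c = (M - (M - 2 * r * c)) / (2 * r) := by field_simp; ring
    generalize hPe : M - 2 * r * c = P at hp hc ⊢
    subst hc
    have hMr : r ^ 2 = M - 1 := by rw [hM]; ring
    field_simp
    rw [hM]
    ring
  have hcont : ∀ x : ℝ, HasDerivAt (fun x => F (Real.pi * x) / Real.pi)
      ((1 + 1 / (1 - 2 * r / M * Real.cos (Real.pi * x))) *
        (Real.sin (Real.pi * x) ^ 2 / (1 - 2 * r / M * Real.cos (Real.pi * x)))) x := by
    intro x
    have h := ((hFd (Real.pi * x)).comp x ((hasDerivAt_id x).const_mul Real.pi)).div_const Real.pi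
    refine h.congr_deriv ?_
    have hp : M - 2 * r * Real.cos (Real.pi * x) ≠ 0 := (hP (Real.pi * x)).ne'
    have e : 1 - 2 * r / M * Real.cos (Real.pi * x) =
        (M - 2 * r * Real.cos (Real.pi * x)) / M := by field_simp
    rw [e]
    have hpi := Real.pi_pos.ne'
    field_simp
  rw [intervalIntegral.integral_eq_sub_of_hasDerivAt (fun x _ => hcont x)]
  · have hpi := Real.pi_pos.ne'
    have hr' := hr2.ne'
    simp only [hF, hA, mul_one, mul_zero, Real.sin_pi, Real.cos_pi, Real.sin_zero, zero_div,
      Real.arctan_zero, add_zero, sub_zero, sub_self]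
    field_simp
    rw [hM]
    ring
  · refine Continuous.intervalIntegrable ?_ _ _
    have hne : ∀ x : ℝ, 1 - 2 * r / M * Real.cos (Real.pi * x) ≠ 0 := fun x => by
      have e : 1 - 2 * r / M * Real.cos (Real.pi * x) =
        (M - 2 * r * Real.cos (Real.pi * x)) / M := by field_simp
      rw [e]
      exact (div_pos (hP _) hMpos).ne'
    have hc : Continuous fun x : ℝ => 1 - 2 * r / M * Real.cos (Real.pi * x) := by fun_prop
    exact (continuous_const.add (continuous_const.div hc hne)).mul
      (Continuous.div (by fun_prop) hc hne)

theorem denominatorValue_eq {p : ℝ} (h0 : 1 / 2 < p) (h1 : p ≤ 1) :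
    denominatorValue p = p / (2 * p - 1) := by
  have hp : 0 < p := by linarith
  have h2 : 2 * p - 1 ≠ 0 := by linarith
  -- At `p = 1` the parameter `r` would be 0, while the antiderivative divides by `r`; there the
  -- integral has the factor `1 - p = 0`.
  rcases h1.eq_or_lt with rfl | h1
  · norm_num [denominatorValue]
  have hq : 0 < 1 - p := by linarith
  set r := Real.sqrt ((1 - p) / p) with hr
  have hr0 : 0 < r := Real.sqrt_pos.2 (div_pos hq hp)
  have hr2 : r ^ 2 = (1 - p) / p := Real.sq_sqrt (div_pos hq hp).le
  have hr1 : r < 1 := by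
    rw [hr, Real.sqrt_lt' one_pos, div_lt_iff₀ hp]
    linarith
  have hs : Real.sqrt (p * (1 - p)) = p * r := by
    have : p * r ^ 2 = 1 - p := by rw [hr2]; field_simp
    rw [← this, show p * (p * r ^ 2) = (p * r) ^ 2 by ring, Real.sqrt_sq (by positivity)]
  have hk : 2 * Real.sqrt (p * (1 - p)) = 2 * r / (1 + r ^ 2) := by
    rw [hs, hr2]
    field_simp
    ring
  rw [denominatorValue, hk, integral_sin_sq_div_poisson hr0 hr1, hr2]
  have e1 : 1 + (1 - p) / p = 1 / p := by field_simp; ring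
  have e2 : 1 - (1 - p) / p = (2 * p - 1) / p := by field_simp; ring
  rw [e1, e2]
  generalize hs : 2 * p - 1 = s at h2 ⊢
  field_simp
  linear_combination -hs

/-! ### Integration over the erasure channel -/

theorem measurable_of_dependsOn_finset {β : Type*} [MeasurableSpace β] {f : (ℕ → Bool) → β}
    {s : Finset ℕ} (hf : DependsOn f (s : Set ℕ)) : Measurable f := by
  have : f = (fun y : s → Bool => f fun n => if h : n ∈ s then y ⟨n, h⟩ else false) ∘
      s.restrict := by
    ext e
    refine hf fun n hn => ?_
    simp [Finset.mem_coe.1 hn]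
  rw [this]
  exact (measurable_of_finite _).comp (Finset.measurable_restrict s)

theorem integrable_of_dependsOn_finset (p : unitInterval) {f : (ℕ → Bool) → ℝ}
    {s : Finset ℕ} (hf : DependsOn f (s : Set ℕ)) : Integrable f (channelMeasure p) := by
  have h : f = (fun y : s → Bool => f fun n => if h : n ∈ s then y ⟨n, h⟩ else false) ∘
      s.restrict := by
    ext e
    refine hf fun n hn => ?_
    simp [Finset.mem_coe.1 hn]
  obtain ⟨C, hC⟩ := (Set.finite_range fun y : s → Bool =>
    ‖f fun n => if h : n ∈ s then y ⟨n, h⟩ else false‖).bddAbove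
  refine Integrable.of_bound (measurable_of_dependsOn_finset hf).aestronglyMeasurable C
    (Eventually.of_forall fun e => ?_)
  rw [h]
  exact hC ⟨s.restrict e, rfl⟩

theorem measurable_update_pair (n : ℕ) :
    Measurable fun z : Bool × (ℕ → Bool) => Function.update z.2 n z.1 := by
  refine measurable_pi_lambda _ fun m => ?_
  by_cases h : m = n
  · subst h
    simpa using measurable_fst
  · simp only [Function.update_of_ne h]
    exact (measurable_pi_apply m).comp measurable_snd

/-- Resampling one coordinate independently preserves a product measure; with Fubini this yields
conditioning on a single slot. -/
theorem map_update_channelMeasure (p : unitInterval) (n : ℕ) :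
    ((bernoulliMeasure false true p).prod (channelMeasure p)).map
      (fun z => Function.update z.2 n z.1) = channelMeasure p := by
  refine Measure.eq_infinitePi _ fun s t ht => ?_
  rw [Measure.map_apply (measurable_update_pair n)
    (MeasurableSet.pi s.countable_toSet fun i _ => ht i)]
  have hset : (fun z : Bool × (ℕ → Bool) => Function.update z.2 n z.1) ⁻¹' (s : Set ℕ).pi t =
      (if n ∈ s then t n else Set.univ) ×ˢ ((s.erase n : Finset ℕ) : Set ℕ).pi t := by
    ext ⟨b, e⟩
    simp only [Set.mem_preimage, Set.mem_pi, Set.mem_prod, Finset.coe_erase]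
    constructor
    · intro h
      refine ⟨?_, fun i hi => ?_⟩
      · split_ifs with hn
        · simpa using h n hn
        · trivial
      · have := h i hi.1
        rwa [Function.update_of_ne hi.2] at this
    · rintro ⟨h1, h2⟩ i hi
      by_cases hin : i = n
      · subst hin
        rw [if_pos (by simpa using hi)] at h1
        simpa using h1
      · rw [Function.update_of_ne hin]
        exact h2 i ⟨hi, hin⟩
  rw [hset, Measure.prod_prod, channelMeasure, Measure.infinitePi_pi _ fun i _ => ht i]
  split_ifs with hn
  · rw [Finset.mul_prod_erase s (fun i => bernoulliMeasure false true p (t i)) hn]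
  · rw [measure_univ, one_mul, Finset.erase_eq_of_notMem hn]

/-- Conditioning on one slot of the channel. -/
theorem integral_channelMeasure_eq_update (p : unitInterval) (n : ℕ) {f : (ℕ → Bool) → ℝ}
    {s : Finset ℕ} (hf : DependsOn f (s : Set ℕ)) :
    ∫ e, f e ∂channelMeasure p =
      ∫ e, (p * f (Function.update e n false) + (1 - p) * f (Function.update e n true))
        ∂channelMeasure p := by
  have hd : ∀ b, DependsOn (fun e => f (Function.update e n b)) (s : Set ℕ) := by
    intro b e e' h
    refine hf fun i hi => ?_
    by_cases hin : i = n
    · subst hin; simp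
    · simp [Function.update_of_ne hin, h i hi]
  have hint := integrable_of_dependsOn_finset p hf
  have hi := fun b => integrable_of_dependsOn_finset p (hd b)
  conv_lhs => rw [← map_update_channelMeasure p n]
  rw [integral_map (measurable_update_pair n).aemeasurable
    (measurable_of_dependsOn_finset hf).aestronglyMeasurable, integral_prod]
  · rw [bernoulliMeasure_def, integral_add_measure, integral_smul_nnreal_measure,
      integral_smul_nnreal_measure, integral_dirac, integral_dirac,
      integral_add ((hi false).const_mul _) ((hi true).const_mul _), integral_const_mul,
      integral_const_mul]
    · rfl
    · exact Integrable.of_finite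
    · exact Integrable.of_finite
  · rw [← map_update_channelMeasure p n] at hint
    exact (integrable_map_measure (measurable_of_dependsOn_finset hf).aestronglyMeasurable
      (measurable_update_pair n).aemeasurable).1 hint

/-! ### The information debt -/

/-- The number of source vectors that the delivered packets of the slots `1, …, n` leave
undetermined since the last slot at which everything was determined: the walk reflected at `0`
that steps up at an erasure and down at a delivery. -/
def informationDebt (e : ℕ → Bool) : ℕ → ℕ
  | 0 => 0
  | n + 1 => if e (n + 1) = true then informationDebt e n + 1 else informationDebt e n - 1

theorem informationDebt_congr {e e' : ℕ → Bool} {n : ℕ}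
    (h : ∀ m, 1 ≤ m → m ≤ n → e m = e' m) : informationDebt e n = informationDebt e' n := by
  induction n with
  | zero => rfl
  | succ n ih =>
    simp only [informationDebt]
    rw [ih fun m h1 h2 => h m h1 (by omega), h (n + 1) (by omega) le_rfl]

theorem informationDebt_le (e : ℕ → Bool) (n : ℕ) : informationDebt e n ≤ n := by
  induction n with
  | zero => rfl
  | succ n ih =>
    simp only [informationDebt]
    split_ifs <;> omega

theorem dependsOn_informationDebt (n : ℕ) :
    DependsOn (fun e => informationDebt e n) ((Finset.Icc 1 n : Finset ℕ) : Set ℕ) :=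
  fun e e' h => informationDebt_congr fun m h1 h2 => h m (by simp [h1, h2])

/-- The walk that is at `k` at time `n` stays positive at the times `n, …, n + m`. -/
def staysPositive (e : ℕ → Bool) : ℕ → ℕ → ℕ → Prop
  | 0, k, _ => 1 ≤ k
  | m + 1, k, n =>
    1 ≤ k ∧ staysPositive e m (if e (n + 1) = true then k + 1 else k - 1) (n + 1)

theorem staysPositive_informationDebt_iff (e : ℕ → Bool) (m n : ℕ) :
    staysPositive e m (informationDebt e n) n ↔
      ∀ i, n ≤ i → i ≤ n + m → 1 ≤ informationDebt e i := by
  induction m generalizing n with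
  | zero =>
    simp only [staysPositive, add_zero]
    exact ⟨fun h i h1 h2 => by rwa [le_antisymm h2 h1], fun h => h n le_rfl le_rfl⟩
  | succ m ih =>
    have := ih (n + 1)
    simp only [informationDebt] at this
    simp only [staysPositive, this]
    constructor
    · rintro ⟨h1, h2⟩ i hi hi'
      rcases hi.eq_or_lt with rfl | hi
      · exact h1
      · exact h2 i hi (by omega)
    · exact fun h => ⟨h n le_rfl (by omega), fun i h1 h2 => h i (by omega) (by omega)⟩

-- The Markov property: given the first `n` slots, only the position `X` matters for the future. The
-- weight `ψ` and the position are arbitrary functions of the past so that the induction can absorb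
-- the condition `1 ≤ X` into `ψ` and the next step into `X`.
open Classical in
theorem integral_mul_staysPositive (p : unitInterval) (m n : ℕ) {X : (ℕ → Bool) → ℕ}
    {ψ : (ℕ → Bool) → ℝ} (hX : DependsOn X ((Finset.Icc 1 n : Finset ℕ) : Set ℕ))
    (hψ : DependsOn ψ ((Finset.Icc 1 n : Finset ℕ) : Set ℕ)) :
    ∫ e, ψ e * (if staysPositive e m (X e) n then 1 else 0) ∂channelMeasure p =
      ∫ e, ψ e * survivalProb p m (X e) ∂channelMeasure p := by
  induction m generalizing n X ψ with
  | zero =>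
    refine integral_congr_ae (Eventually.of_forall fun e => ?_)
    simp only [staysPositive]
    cases X e <;> simp [survivalProb]
  | succ m ih =>
    have hsub : ∀ i ∈ ((Finset.Icc 1 n : Finset ℕ) : Set ℕ),
        i ∈ ((Finset.Icc 1 (n + 1) : Finset ℕ) : Set ℕ) := fun i hi => by
      simp only [Finset.coe_Icc, Set.mem_Icc] at hi ⊢
      omega
    have hX' : DependsOn (fun e => if e (n + 1) = true then X e + 1 else X e - 1)
        ((Finset.Icc 1 (n + 1) : Finset ℕ) : Set ℕ) := by
      intro e e' h
      simp only
      rw [hX fun i hi => h i (hsub i hi), h (n + 1) (by simp)]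
    have hψ' : DependsOn (fun e => ψ e * (if 1 ≤ X e then 1 else 0))
        ((Finset.Icc 1 (n + 1) : Finset ℕ) : Set ℕ) := by
      intro e e' h
      simp only
      rw [hX fun i hi => h i (hsub i hi), hψ fun i hi => h i (hsub i hi)]
    have e1 : ∀ e, ψ e * (if staysPositive e (m + 1) (X e) n then 1 else 0) =
        ψ e * (if 1 ≤ X e then 1 else 0) *
          (if staysPositive e m (if e (n + 1) = true then X e + 1 else X e - 1) (n + 1)
            then 1 else 0) := by
      intro e
      simp only [staysPositive]
      by_cases h1 : 1 ≤ X e <;> simp [h1]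
    simp only [e1]
    rw [ih (n + 1) hX' hψ', integral_channelMeasure_eq_update p (n + 1)
      (s := Finset.Icc 1 (n + 1))]
    · refine integral_congr_ae (Eventually.of_forall fun e => ?_)
      have hXu : ∀ b, X (Function.update e (n + 1) b) = X e := fun b => hX fun i hi => by
        simp only [Finset.coe_Icc, Set.mem_Icc] at hi
        exact Function.update_of_ne (by omega) _ _
      have hψu : ∀ b, ψ (Function.update e (n + 1) b) = ψ e := fun b => hψ fun i hi => by
        simp only [Finset.coe_Icc, Set.mem_Icc] at hi
        exact Function.update_of_ne (by omega) _ _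
      simp only [hXu, hψu, Function.update_self]
      cases X e with
      | zero => simp
      | succ k =>
        simp [survivalProb]
        ring
    · intro e e' h
      have a := hX' h
      have b := hψ' h
      simp only at a b ⊢
      rw [a, b]

-- Conditioning on the last slot reproduces the recursion of `reflectedTail`. Truncated subtraction
-- is the reflection: `k + 1 ≤ d - 1` means `k + 2 ≤ d` even for `d = 0`.
open Classical in
theorem integral_informationDebt_ge (p : unitInterval) (n k : ℕ) :
    ∫ e, (if k ≤ informationDebt e n then (1 : ℝ) else 0) ∂channelMeasure p =
      reflectedTail p n k := by
  induction n generalizing k with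
  | zero => cases k <;> simp [informationDebt, reflectedTail]
  | succ n ih =>
    cases k with
    | zero => simp
    | succ k =>
      rw [integral_channelMeasure_eq_update p (n + 1) (s := Finset.Icc 1 (n + 1))]
      · have hd : ∀ b e, informationDebt (Function.update e (n + 1) b) n = informationDebt e n :=
          fun b e => informationDebt_congr fun m h1 h2 => Function.update_of_ne (by omega) _ _
        simp only [informationDebt, hd, Function.update_self]
        have a : ∀ e, k + 1 ≤ informationDebt e n - 1 ↔ k + 2 ≤ informationDebt e n :=
          fun e => by omega
        simp only [Bool.false_eq_true, if_false, if_true, a, add_le_add_iff_right]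
        have hi : ∀ j, Integrable (fun e => if j ≤ informationDebt e n then (1 : ℝ) else 0)
            (channelMeasure p) := fun j =>
          integrable_of_dependsOn_finset p (s := Finset.Icc 1 n) fun e e' h => by
            have := dependsOn_informationDebt n h
            simp only at this ⊢
            rw [this]
        rw [integral_add ((hi _).const_mul _) ((hi _).const_mul _), integral_const_mul,
          integral_const_mul, ih, ih, add_comm]
        rfl
      · intro e e' h
        have := dependsOn_informationDebt (n + 1) h
        simp only at this ⊢
        rw [this]

/-- The probability that slot `t + 1` is erased and that the information debt then stays positive
for `Δ` further slots. -/
theorem channelMeasure_real_erased_staysPositive (p : unitInterval) (Δ t : ℕ) :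
    (channelMeasure p).real {e | e (t + 1) = true ∧
      ∀ i, t + 1 ≤ i → i ≤ t + 1 + Δ → 1 ≤ informationDebt e i} =
    (1 - p) * ∑ k ∈ Finset.range (t + 1),
      (reflectedTail p t k - reflectedTail p t (k + 1)) * survivalProb p Δ (k + 1) := by
  classical
  have hψ : DependsOn (fun e : ℕ → Bool => if e (t + 1) = true then (1 : ℝ) else 0)
      ((Finset.Icc 1 (t + 1) : Finset ℕ) : Set ℕ) := by
    intro e e' h
    simp only
    rw [h (t + 1) (by simp)]
  have hm : MeasurableSet {e : ℕ → Bool | e (t + 1) = true ∧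
      ∀ i, t + 1 ≤ i → i ≤ t + 1 + Δ → 1 ≤ informationDebt e i} := by
    refine measurableSet_setOfPred.2 (measurable_of_dependsOn_finset
      (s := Finset.Icc 1 (t + 1 + Δ)) fun e e' h => ?_)
    simp only [eq_iff_iff]
    rw [h (t + 1) (by simp)]
    refine and_congr_right fun _ => forall_congr' fun i => forall_congr' fun h1 =>
      forall_congr' fun h2 => ?_
    rw [informationDebt_congr fun m hm hm' => h m (by simp [hm]; omega)]
  have hD := dependsOn_informationDebt (t + 1)
  rw [← integral_indicator_one hm]
  have e1 : ∀ e : ℕ → Bool, Set.indicator {e : ℕ → Bool | e (t + 1) = true ∧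
      ∀ i, t + 1 ≤ i → i ≤ t + 1 + Δ → 1 ≤ informationDebt e i} (1 : (ℕ → Bool) → ℝ) e =
      (if e (t + 1) = true then (1 : ℝ) else 0) *
        (if staysPositive e Δ (informationDebt e (t + 1)) (t + 1) then 1 else 0) := by
    intro e
    rw [Set.indicator_apply]
    simp only [Set.mem_ofPred_eq, ← staysPositive_informationDebt_iff]
    by_cases h1 : e (t + 1) = true <;> simp [h1]
  simp only [e1]
  rw [integral_mul_staysPositive p Δ (t + 1) hD hψ,
    integral_channelMeasure_eq_update p (t + 1) (s := Finset.Icc 1 (t + 1))]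
  · have hd : ∀ b e, informationDebt (Function.update e (t + 1) b) t = informationDebt e t :=
      fun b e => informationDebt_congr fun m h1 h2 => Function.update_of_ne (by omega) _ _
    simp only [informationDebt, hd, Function.update_self, Bool.false_eq_true, if_false, if_true,
      zero_mul, mul_zero, zero_add, one_mul]
    rw [integral_const_mul]
    congr 1
    -- The difference of the two indicators is the indicator of debt `k`, and the debt at time `t`
    -- is at most `t`.
    have e2 : ∀ e, survivalProb p Δ (informationDebt e t + 1) =
        ∑ k ∈ Finset.range (t + 1), ((if k ≤ informationDebt e t then (1 : ℝ) else 0) -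
          (if k + 1 ≤ informationDebt e t then (1 : ℝ) else 0)) *
            survivalProb p Δ (k + 1) := by
      intro e
      rw [Finset.sum_eq_single (informationDebt e t)]
      · simp
      · intro k _ hk
        have : k ≤ informationDebt e t ↔ k + 1 ≤ informationDebt e t := by omega
        simp [this]
      · intro h
        have := informationDebt_le e t
        simp at h
        omega
    simp only [e2]
    have hi : ∀ j, Integrable (fun e => if j ≤ informationDebt e t then (1 : ℝ) else 0)
        (channelMeasure p) := fun j =>
      integrable_of_dependsOn_finset p (s := Finset.Icc 1 t) fun e e' h => by
        have := dependsOn_informationDebt t h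
        simp only at this ⊢
        rw [this]
    have hi' : ∀ k ∈ Finset.range (t + 1), Integrable (fun e =>
        ((if k ≤ informationDebt e t then (1 : ℝ) else 0) -
          (if k + 1 ≤ informationDebt e t then (1 : ℝ) else 0)) * survivalProb p Δ (k + 1))
        (channelMeasure p) := fun k _ => ((hi k).sub (hi (k + 1))).mul_const _
    rw [integral_finsetSum _ hi']
    refine Finset.sum_congr rfl fun k _ => ?_
    rw [integral_mul_const, integral_sub (hi _) (hi _), integral_informationDebt_ge,
      integral_informationDebt_ge]
  · intro e e' h
    have a := hD h
    have b := hψ h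
    simp only at a b ⊢
    rw [a, b]

/-! ### Generic decodability -/

/-- The index set of the random coefficients. -/
abbrev CoeffIndex (K N : ℕ) : Type := (ℕ × Fin N) × (ℕ × Fin K)

/-- The field of rational functions over `GF(2)` in one variable for every random coefficient. -/
abbrev GenericField (K N : ℕ) : Type := FractionRing (MvPolynomial (CoeffIndex K N) (ZMod 2))

/-- The generic coefficients: algebraically independent variables. -/
def genericCoeff (K N : ℕ) (i : CoeffIndex K N) : GenericField K N :=
  algebraMap (MvPolynomial (CoeffIndex K N) (ZMod 2)) _ (MvPolynomial.X i)

/-- Decodability for generic coefficients. -/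
def IsGenericallyDecodable (K N : ℕ) (α : ℕ∞) (Δ : ℕ) (e : ℕ → Bool) (t : ℕ) : Prop :=
  IsDecodable K N α Δ (genericCoeff K N) e t

/-- The generator matrix with polynomial entries. -/
def polynomialGenerator (K N : ℕ) (α : ℕ∞) (r : ℕ × Fin N) (v : ℕ × Fin K) :
    MvPolynomial (CoeffIndex K N) (ZMod 2) :=
  if (r.2 : ℕ) < K then
    (if v.1 = r.1 ∧ (v.2 : ℕ) = (r.2 : ℕ) then 1 else 0)
  else
    (if 1 ≤ v.1 ∧ v.1 ≤ r.1 ∧ (r.1 : ℕ∞) ≤ (v.1 : ℕ∞) + α then MvPolynomial.X (r, v) else 0)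

theorem cumulativeGenerator_specialize {K N : ℕ} (α : ℕ∞) {F : Type*} [Field F]
    (φ : MvPolynomial (CoeffIndex K N) (ZMod 2) →+* F) (r : ℕ × Fin N) (v : ℕ × Fin K) :
    cumulativeGenerator K N α (fun i => φ (MvPolynomial.X i)) r v =
      φ (polynomialGenerator K N α r v) := by
  simp only [cumulativeGenerator, polynomialGenerator]
  split_ifs <;> simp

theorem cumulativeGenerator_genericCoeff {K N : ℕ} (α : ℕ∞) (r : ℕ × Fin N) (v : ℕ × Fin K) :
    cumulativeGenerator K N α (genericCoeff K N) r v =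
      algebraMap _ (GenericField K N) (polynomialGenerator K N α r v) :=
  cumulativeGenerator_specialize α (algebraMap _ (GenericField K N)) r v

theorem cumulativeGenerator_eq_zero_of_lt {K N : ℕ} (α : ℕ∞) {F : Type*} [Field F]
    (c : CoeffIndex K N → F) {r : ℕ × Fin N} {v : ℕ × Fin K} (h : r.1 < v.1) :
    cumulativeGenerator K N α c r v = 0 := by
  simp only [cumulativeGenerator]
  split_ifs with _ h1 h1
  · omega
  · rfl
  · omega
  · rfl

theorem row_eq_sum_single {K N : ℕ} (α : ℕ∞) {F : Type*} [Field F] (c : CoeffIndex K N → F)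
    (r : ℕ × Fin N) {n : ℕ} (h : r.1 ≤ n) :
    (cumulativeGenerator K N α c).row r =
      ∑ u ∈ Finset.range (n + 1) ×ˢ Finset.univ,
        cumulativeGenerator K N α c r u • (Pi.single u 1 : ℕ × Fin K → F) := by
  ext v
  rw [Finset.sum_apply]
  by_cases hv : v ∈ Finset.range (n + 1) ×ˢ (Finset.univ : Finset (Fin K))
  · rw [Finset.sum_eq_single v]
    · simp
    · intro u _ hu
      simp [Pi.single_eq_of_ne hu.symm]
    · exact fun h => absurd hv h
  · rw [Finset.sum_eq_zero]
    · refine cumulativeGenerator_eq_zero_of_lt α _ ?_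
      simp at hv
      omega
    · intro u hu
      have : v ≠ u := fun h => hv (h ▸ hu)
      simp [Pi.single_eq_of_ne this]

theorem receiverRowSpace_congr {K N : ℕ} (α : ℕ∞) {F : Type*} [Field F]
    (c : CoeffIndex K N → F) {e e' : ℕ → Bool} {n : ℕ}
    (h : ∀ m, 1 ≤ m → m ≤ n → e m = e' m) :
    receiverRowSpace K N α c e n = receiverRowSpace K N α c e' n := by
  have : {r : ℕ × Fin N | 1 ≤ r.1 ∧ r.1 ≤ n ∧ e r.1 = false} =
      {r | 1 ≤ r.1 ∧ r.1 ≤ n ∧ e' r.1 = false} := by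
    ext r
    simp only [Set.mem_ofPred_eq]
    refine and_congr_right fun h1 => and_congr_right fun h2 => ?_
    rw [h _ h1 h2]
  rw [receiverRowSpace, receiverRowSpace, this]

theorem isDecodable_congr {K N : ℕ} (α : ℕ∞) (Δ : ℕ) {F : Type*} [Field F]
    (c : CoeffIndex K N → F) {e e' : ℕ → Bool} {t : ℕ}
    (h : ∀ m, 1 ≤ m → m ≤ t + Δ → e m = e' m) :
    IsDecodable K N α Δ c e t ↔ IsDecodable K N α Δ c e' t := by
  rw [IsDecodable, IsDecodable, receiverRowSpace_congr α c h]

/-- A functional that kills every received row but not the unit row separates the two. Summing over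
slots up to `n` keeps the functional finite. -/
theorem not_mem_receiverRowSpace_of_kernel {K N : ℕ} (α : ℕ∞) {F : Type*} [Field F]
    (c : CoeffIndex K N → F) (e : ℕ → Bool) (n : ℕ) (w : ℕ × Fin K → F) {v : ℕ × Fin K}
    (hv : v.1 ≤ n) (hw : w v ≠ 0)
    (hker : ∀ r : ℕ × Fin N, 1 ≤ r.1 → r.1 ≤ n → e r.1 = false →
      ∑ u ∈ Finset.range (n + 1) ×ˢ Finset.univ, cumulativeGenerator K N α c r u * w u = 0) :
    (Pi.single v 1 : ℕ × Fin K → F) ∉ receiverRowSpace K N α c e n := by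
  intro hmem
  set g : (ℕ × Fin K → F) →ₗ[F] F :=
    ∑ u ∈ Finset.range (n + 1) ×ˢ Finset.univ, (w u) • LinearMap.proj u with hg
  have hgx : ∀ x, g x = ∑ u ∈ Finset.range (n + 1) ×ˢ Finset.univ, x u * w u := fun x => by
    simp [hg, LinearMap.sum_apply, mul_comm]
  have hle : receiverRowSpace K N α c e n ≤ LinearMap.ker g := by
    refine Submodule.span_le.2 ?_
    rintro _ ⟨r, ⟨h1, h2, h3⟩, rfl⟩
    rw [SetLike.mem_coe, LinearMap.mem_ker, hgx]
    exact hker r h1 h2 h3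
  have h := LinearMap.mem_ker.1 (hle hmem)
  rw [hgx, Finset.sum_eq_single v] at h
  · simp at h
    exact hw h
  · intro u _ hu
    simp [Pi.single_eq_of_ne hu]
  · intro h'
    simp at h'
    omega

/-- Over the generic field some functional kills the row space but not the unit row. After clearing
denominators its values are polynomials `w`, and every specialization with `w (t, k)` nonzero
retains a separating functional. -/
theorem exists_specialization_not_isDecodable {K N : ℕ} {α : ℕ∞} {Δ : ℕ} {e : ℕ → Bool} {t : ℕ}
    (h : ¬ IsGenericallyDecodable K N α Δ e t) :
    ∃ P : MvPolynomial (CoeffIndex K N) (ZMod 2), P ≠ 0 ∧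
      ∀ (F : Type) [Field F] (φ : MvPolynomial (CoeffIndex K N) (ZMod 2) →+* F), φ P ≠ 0 →
        ¬ IsDecodable K N α Δ (fun i => φ (MvPolynomial.X i)) e t := by
  simp only [IsGenericallyDecodable, IsDecodable, not_forall] at h
  obtain ⟨k, hk⟩ := h
  obtain ⟨f, hf, hW⟩ := Submodule.exists_le_ker_of_notMem hk
  set n := t + Δ with hn
  set S : Finset (ℕ × Fin K) := Finset.range (n + 1) ×ˢ Finset.univ with hS
  have htS : (t, k) ∈ S := by
    simp [hS]
    omega
  obtain ⟨b, hb⟩ := IsLocalization.exist_integer_multiples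
    (nonZeroDivisors (MvPolynomial (CoeffIndex K N) (ZMod 2))) S
    (fun u => f (Pi.single u 1))
  choose! w hw using hb
  have hb0 : algebraMap _ (GenericField K N) (b : MvPolynomial (CoeffIndex K N) (ZMod 2)) ≠ 0 :=
    IsFractionRing.to_map_ne_zero_of_mem_nonZeroDivisors b.2
  refine ⟨w (t, k), ?_, fun F _ φ hφ hdec => ?_⟩
  · intro h0
    have := hw _ htS
    rw [h0, map_zero, Algebra.smul_def] at this
    exact (mul_ne_zero hb0 hf) this.symm
  · refine not_mem_receiverRowSpace_of_kernel α _ e n (fun u => φ (w u)) (v := (t, k))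
      (by simp [hn]) hφ (fun r h1 h2 h3 => ?_) (hdec k)
    have hrow := row_eq_sum_single α (genericCoeff K N) r h2
    have hfr : f ((cumulativeGenerator K N α (genericCoeff K N)).row r) = 0 :=
      LinearMap.mem_ker.1 (hW (Submodule.subset_span ⟨r, ⟨h1, h2, h3⟩, rfl⟩))
    have hpoly : ∑ u ∈ S, polynomialGenerator K N α r u * w u = 0 := by
      apply IsFractionRing.injective (MvPolynomial (CoeffIndex K N) (ZMod 2)) (GenericField K N)
      rw [map_zero, map_sum]
      rw [hrow, map_sum] at hfr
      rw [← mul_zero (algebraMap _ (GenericField K N)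
        (b : MvPolynomial (CoeffIndex K N) (ZMod 2))), ← hfr, Finset.mul_sum]
      refine Finset.sum_congr rfl fun u hu => ?_
      rw [map_mul, hw u hu, cumulativeGenerator_genericCoeff, map_smul, Algebra.smul_def,
        smul_eq_mul]
      ring
    simp only [cumulativeGenerator_specialize]
    rw [← hS]
    simp only [← map_mul]
    rw [← map_sum, hpoly, map_zero]

/-- A linear combination of rows that gives the unit row specializes wherever the common denominator
`b` of its coefficients does not vanish. One denominator is used for each `k`. -/
theorem exists_specialization_isDecodable {K N : ℕ} {α : ℕ∞} {Δ : ℕ} {e : ℕ → Bool} {t : ℕ}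
    (h : IsGenericallyDecodable K N α Δ e t) :
    ∃ P : MvPolynomial (CoeffIndex K N) (ZMod 2), P ≠ 0 ∧
      ∀ (F : Type) [Field F] (φ : MvPolynomial (CoeffIndex K N) (ZMod 2) →+* F), φ P ≠ 0 →
        IsDecodable K N α Δ (fun i => φ (MvPolynomial.X i)) e t := by
  have key : ∀ k : Fin K, ∃ P : MvPolynomial (CoeffIndex K N) (ZMod 2), P ≠ 0 ∧
      ∀ (F : Type) [Field F] (φ : MvPolynomial (CoeffIndex K N) (ZMod 2) →+* F), φ P ≠ 0 →
        (Pi.single (t, k) 1 : ℕ × Fin K → F) ∈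
          receiverRowSpace K N α (fun i => φ (MvPolynomial.X i)) e (t + Δ) := by
    intro k
    obtain ⟨l, hl, hlin⟩ := (Finsupp.mem_span_image_iff_linearCombination _).1 (h k)
    obtain ⟨b, hb⟩ := IsLocalization.exist_integer_multiples
      (nonZeroDivisors (MvPolynomial (CoeffIndex K N) (ZMod 2))) l.support l
    choose! a ha using hb
    refine ⟨b, nonZeroDivisors.coe_ne_zero b, fun F _ φ hφ => ?_⟩
    have hpoly : ∀ v, ∑ r ∈ l.support, a r * polynomialGenerator K N α r v =
        (b : MvPolynomial (CoeffIndex K N) (ZMod 2)) * (if v = (t, k) then 1 else 0) := by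
      intro v
      apply IsFractionRing.injective (MvPolynomial (CoeffIndex K N) (ZMod 2)) (GenericField K N)
      have := congrFun hlin v
      rw [Finsupp.linearCombination_apply, Finsupp.sum, Finset.sum_apply] at this
      rw [map_sum, map_mul]
      have hs : algebraMap _ (GenericField K N)
          (if v = (t, k) then (1 : MvPolynomial (CoeffIndex K N) (ZMod 2)) else 0) =
          (Pi.single (t, k) 1 : ℕ × Fin K → GenericField K N) v := by
        rw [Pi.single_apply]
        split_ifs <;> simp
      rw [hs, ← this, Finset.mul_sum]
      refine Finset.sum_congr rfl fun r hr => ?_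
      rw [map_mul, ha r hr, Algebra.smul_def, Pi.smul_apply, smul_eq_mul, Matrix.row,
        cumulativeGenerator_genericCoeff]
      ring
    have heq : (Pi.single (t, k) 1 : ℕ × Fin K → F) = ∑ r ∈ l.support,
        ((φ b)⁻¹ * φ (a r)) •
          (cumulativeGenerator K N α (fun i => φ (MvPolynomial.X i))).row r := by
      ext v
      have := congrArg φ (hpoly v)
      rw [map_sum, map_mul] at this
      rw [Finset.sum_apply]
      simp only [Pi.smul_apply, smul_eq_mul, Matrix.row, cumulativeGenerator_specialize,
        mul_assoc]
      rw [← Finset.mul_sum]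
      simp only [← map_mul] at this ⊢
      rw [← map_sum] at this ⊢
      rw [this, map_mul, inv_mul_cancel_left₀ hφ, Pi.single_apply]
      split_ifs <;> simp
    rw [heq]
    refine Submodule.sum_mem _ fun r hr => Submodule.smul_mem _ _ (Submodule.subset_span ?_)
    exact ⟨r, hl hr, rfl⟩
  choose P hP0 hP using key
  refine ⟨∏ k, P k, Finset.prod_ne_zero_iff.2 fun k _ => hP0 k, fun F _ φ hφ k => ?_⟩
  rw [map_prod] at hφ
  exact hP k F φ (Finset.prod_ne_zero_iff.1 hφ k (Finset.mem_univ k))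

theorem isGenericallyDecodable_congr {K N : ℕ} (α : ℕ∞) (Δ : ℕ) {e e' : ℕ → Bool} {t : ℕ}
    (h : ∀ m, 1 ≤ m → m ≤ t + Δ → e m = e' m) :
    IsGenericallyDecodable K N α Δ e t ↔ IsGenericallyDecodable K N α Δ e' t :=
  isDecodable_congr α Δ _ h

/-- Outside a hypersurface decodability coincides with generic decodability, for all erasure
patterns. -/
theorem exists_specialization_iff (K N : ℕ) (α : ℕ∞) (Δ t : ℕ) :
    ∃ P : MvPolynomial (CoeffIndex K N) (ZMod 2), P ≠ 0 ∧
      ∀ (F : Type) [Field F] (φ : MvPolynomial (CoeffIndex K N) (ZMod 2) →+* F), φ P ≠ 0 →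
        ∀ e, (IsDecodable K N α Δ (fun i => φ (MvPolynomial.X i)) e t ↔
          IsGenericallyDecodable K N α Δ e t) := by
  have key : ∀ e : ℕ → Bool, ∃ P : MvPolynomial (CoeffIndex K N) (ZMod 2), P ≠ 0 ∧
      ∀ (F : Type) [Field F] (φ : MvPolynomial (CoeffIndex K N) (ZMod 2) →+* F), φ P ≠ 0 →
        (IsDecodable K N α Δ (fun i => φ (MvPolynomial.X i)) e t ↔
          IsGenericallyDecodable K N α Δ e t) := by
    intro e
    by_cases h : IsGenericallyDecodable K N α Δ e t
    · obtain ⟨P, h0, hP⟩ := exists_specialization_isDecodable h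
      exact ⟨P, h0, fun F _ φ hφ => iff_of_true (hP F φ hφ) h⟩
    · obtain ⟨P, h0, hP⟩ := exists_specialization_not_isDecodable h
      exact ⟨P, h0, fun F _ φ hφ => iff_of_false (hP F φ hφ) h⟩
  choose P hP0 hP using key
  -- Only slots up to `t + Δ` matter, so finitely many patterns suffice and the exceptional
  -- polynomials can be multiplied.
  let patt : (Fin (t + Δ + 1) → Bool) → ℕ → Bool :=
    fun y i => if h : i < t + Δ + 1 then y ⟨i, h⟩ else false
  refine ⟨∏ y, P (patt y), Finset.prod_ne_zero_iff.2 fun y _ => hP0 _, fun F _ φ hφ e => ?_⟩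
  rw [map_prod] at hφ
  have h := hP _ F φ (Finset.prod_ne_zero_iff.1 hφ (fun i => e i) (Finset.mem_univ _))
  have he : ∀ m, 1 ≤ m → m ≤ t + Δ → e m = patt (fun i => e i) m := fun m _ hm => by
    simp [patt, hm]
  rw [isDecodable_congr α Δ _ he, isGenericallyDecodable_congr α Δ he, h]

/-! ### Shifting the time -/

/-- The index of a coefficient one slot later. -/
def shiftCoeffIndex {K N : ℕ} (i : CoeffIndex K N) : CoeffIndex K N :=
  ((i.1.1 + 1, i.1.2), (i.2.1 + 1, i.2.2))

theorem shiftCoeffIndex_injective {K N : ℕ} :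
    Function.Injective (shiftCoeffIndex : CoeffIndex K N → CoeffIndex K N) := by
  rintro ⟨⟨a, b⟩, c, d⟩ ⟨⟨a', b'⟩, c', d'⟩ h
  simp only [shiftCoeffIndex, Prod.mk.injEq, add_left_inj] at h
  simp [h]

/-- The map `π` forgets the columns of slot 1 and moves the others one slot back. It kills the rows
of slot 1 and sends each later row to the corresponding row of the shifted system. -/
theorem IsDecodable.shift {K N : ℕ} {α : ℕ∞} {Δ : ℕ} {F : Type*} [Field F]
    {c : CoeffIndex K N → F} {e : ℕ → Bool} {t : ℕ} (ht : 1 ≤ t)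
    (h : IsDecodable K N α Δ c e (t + 1)) :
    IsDecodable K N α Δ (fun i => c (shiftCoeffIndex i)) (fun n => e (n + 1)) t := by
  intro k
  set π : (ℕ × Fin K → F) →ₗ[F] (ℕ × Fin K → F) := LinearMap.pi fun v =>
    if v.1 = 0 then 0 else LinearMap.proj (v.1 + 1, v.2) with hπ
  have hπx : ∀ x v, π x v = if v.1 = 0 then 0 else x (v.1 + 1, v.2) := fun x v => by
    simp only [hπ, LinearMap.pi_apply]
    split_ifs <;> simp
  have hsingle : π (Pi.single (t + 1, k) 1) = Pi.single (t, k) 1 := by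
    ext ⟨s, j⟩
    rw [hπx]
    simp only [Pi.single_apply, Prod.mk.injEq, add_left_inj]
    split_ifs <;> first | rfl | omega
  have hmap : (receiverRowSpace K N α c e (t + 1 + Δ)).map π ≤
      receiverRowSpace K N α (fun i => c (shiftCoeffIndex i)) (fun n => e (n + 1)) (t + Δ) := by
    rw [receiverRowSpace, Submodule.map_span_le]
    rintro _ ⟨⟨τ, i⟩, ⟨h1, h2, h3⟩, rfl⟩
    simp only at h1 h2 h3
    obtain ⟨τ, rfl⟩ := Nat.exists_eq_succ_of_ne_zero (by omega : τ ≠ 0)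
    by_cases hτ : τ = 0
    · convert Submodule.zero_mem _
      ext ⟨s, j⟩
      rw [hπx]
      simp only [Matrix.row, cumulativeGenerator, Pi.zero_apply]
      split_ifs <;> first | rfl | omega
    · have : π ((cumulativeGenerator K N α c).row (τ.succ, i)) =
          (cumulativeGenerator K N α (fun i => c (shiftCoeffIndex i))).row (τ, i) := by
        ext ⟨s, j⟩
        rw [hπx]
        have hα : ((τ.succ : ℕ) : ℕ∞) ≤ ((s + 1 : ℕ) : ℕ∞) + α ↔ (τ : ℕ∞) ≤ (s : ℕ∞) + α := by
          cases α with
          | top => simp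
          | coe a => norm_cast; omega
        simp only [Matrix.row, cumulativeGenerator, hα, shiftCoeffIndex, Nat.succ_eq_add_one,
          add_left_inj, add_le_add_iff_right]
        by_cases hs : s = 0
        · subst hs
          simp [Ne.symm hτ]
        · simp only [hs, if_false]
          have : 1 ≤ s := by omega
          simp [this]
      rw [this]
      exact Submodule.subset_span ⟨(τ, i), ⟨by simp; omega, by simp; omega, h3⟩, rfl⟩
  rw [← hsingle]
  exact hmap (Submodule.mem_map_of_mem (h k))

/-- Shifted generic coefficients are again independent variables: renaming along an injection keeps
the exceptional polynomial nonzero, so generic failure would survive the shift. -/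
theorem IsGenericallyDecodable.shift {K N : ℕ} {α : ℕ∞} {Δ : ℕ} {e : ℕ → Bool} {t : ℕ}
    (ht : 1 ≤ t) (h : IsGenericallyDecodable K N α Δ e (t + 1)) :
    IsGenericallyDecodable K N α Δ (fun n => e (n + 1)) t := by
  by_contra hcon
  obtain ⟨P, hP0, hP⟩ := exists_specialization_not_isDecodable hcon
  refine hP (GenericField K N) ((algebraMap _ (GenericField K N)).comp
    (MvPolynomial.rename shiftCoeffIndex).toRingHom) ?_ ?_
  · simp only [RingHom.comp_apply]
    intro h0
    refine hP0 (MvPolynomial.rename_injective _ shiftCoeffIndex_injective ?_)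
    rw [map_zero]
    apply IsFractionRing.injective (MvPolynomial (CoeffIndex K N) (ZMod 2)) (GenericField K N)
    rw [map_zero]
    exact h0
  · have := IsDecodable.shift ht h
    convert this using 2
    simp [genericCoeff]

/-! ### Large fields -/

theorem map_comp_infinitePi_const {ι κ X : Type*} [MeasurableSpace X] (μ : Measure X)
    [IsProbabilityMeasure μ] {f : κ → ι} (hf : Function.Injective f) :
    (Measure.infinitePi fun _ : ι => μ).map (fun x => x ∘ f) =
      Measure.infinitePi fun _ : κ => μ := by
  classical
  refine Measure.eq_infinitePi _ fun s t ht => ?_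
  have hm : Measurable fun x : ι → X => x ∘ f :=
    measurable_pi_lambda _ fun j => measurable_pi_apply (f j)
  rw [Measure.map_apply hm (MeasurableSet.pi s.countable_toSet fun i _ => ht i)]
  have hset : (fun x : ι → X => x ∘ f) ⁻¹' (s : Set κ).pi t =
      ((s.map ⟨f, hf⟩ : Finset ι) : Set ι).pi (Function.extend f t fun _ => Set.univ) := by
    ext x
    simp only [Set.mem_preimage, Set.mem_pi, Finset.coe_map, Function.Embedding.coeFn_mk,
      Set.forall_mem_image, hf.extend_apply, Function.comp_apply]
  rw [hset, Measure.infinitePi_pi, Finset.prod_map]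
  · simp [hf.extend_apply]
  · intro i hi
    obtain ⟨j, _, rfl⟩ := Finset.mem_map.1 hi
    simpa [hf.extend_apply] using ht j

instance isProbabilityMeasure_uniformOn_compl_zero (q : ℕ) :
    IsProbabilityMeasure (uniformOn ({0}ᶜ : Set (GaloisField 2 q))) :=
  isProbabilityMeasure_uniformOn' (Set.toFinite _) ⟨1, by simp⟩
    MeasurableSpace.measurableSet_top

theorem measurableSingletonClass_galoisField (q : ℕ) :
    MeasurableSingletonClass (GaloisField 2 q) :=
  ⟨fun _ => MeasurableSpace.measurableSet_top⟩

open Classical in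
theorem uniformOn_compl_zero_real_singleton {q : ℕ} (hq : q ≠ 0) (x : GaloisField 2 q) :
    (uniformOn ({0}ᶜ : Set (GaloisField 2 q))).real {x} =
      if x = 0 then 0 else ((2 : ℝ) ^ q - 1)⁻¹ := by
  classical
  have := measurableSingletonClass_galoisField q
  let _ : Fintype (GaloisField 2 q) := Fintype.ofFinite _
  have hc : Fintype.card (GaloisField 2 q) = 2 ^ q := by
    rw [← Nat.card_eq_fintype_card, GaloisField.card 2 q hq]
  have hs : ({0}ᶜ : Set (GaloisField 2 q)) = ((Finset.univ.erase (0 : GaloisField 2 q) : Finset _) : Set _) := by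
    ext y; simp
  have hone : 1 ≤ 2 ^ q := Nat.one_le_two_pow
  rw [Measure.real, hs, ← Finset.coe_singleton, uniformOn_apply_finset, Finset.card_erase_of_mem
    (Finset.mem_univ _), Finset.card_univ, hc]
  split_ifs with hx
  · subst hx
    simp
  · rw [Finset.inter_singleton_of_mem (by simp [hx])]
    rw [Finset.card_singleton, ENNReal.toReal_div, ENNReal.toReal_natCast, ENNReal.toReal_natCast,
      Nat.cast_sub hone]
    simp

/-- The Schwartz-Zippel bound for independent uniform nonzero coefficients. -/
theorem coeffMeasure_real_aeval_eq_zero_le {K N : ℕ} {n : ℕ} {f : Fin n → CoeffIndex K N}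
    (hf : Function.Injective f) {P : MvPolynomial (Fin n) (ZMod 2)} (hP : P ≠ 0) {q : ℕ}
    (hq : q ≠ 0) :
    (coeffMeasure K N q).real {c | MvPolynomial.aeval c (MvPolynomial.rename f P) = 0} ≤
      P.totalDegree / ((2 : ℝ) ^ q - 1) := by
  classical
  have := measurableSingletonClass_galoisField q
  let _ : Fintype (GaloisField 2 q) := Fintype.ofFinite _
  have hc : Fintype.card (GaloisField 2 q) = 2 ^ q := by
    rw [← Nat.card_eq_fintype_card, GaloisField.card 2 q hq]
  have hone : 1 ≤ 2 ^ q := Nat.one_le_two_pow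
  set S : Finset (GaloisField 2 q) := Finset.univ.erase 0 with hS
  have hScard : (S.card : ℝ) = (2 : ℝ) ^ q - 1 := by
    rw [hS, Finset.card_erase_of_mem (Finset.mem_univ _), Finset.card_univ, hc,
      Nat.cast_sub hone]
    simp
  set Z : Finset (Fin n → GaloisField 2 q) :=
    Finset.univ.filter fun x => MvPolynomial.aeval x P = 0 with hZ
  have hpre : {c : CoeffIndex K N → GaloisField 2 q |
      MvPolynomial.aeval c (MvPolynomial.rename f P) = 0} = (fun c => c ∘ f) ⁻¹' (Z : Set _) := by
    ext c
    simp [hZ, MvPolynomial.aeval_rename]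
  have hm : Measurable fun c : CoeffIndex K N → GaloisField 2 q => c ∘ f :=
    measurable_pi_lambda _ fun j => measurable_pi_apply (f j)
  have hmap : (coeffMeasure K N q).map (fun c => c ∘ f) =
      Measure.infinitePi fun _ : Fin n => uniformOn ({0}ᶜ : Set (GaloisField 2 q)) :=
    map_comp_infinitePi_const _ hf
  rw [hpre, ← map_measureReal_apply hm Z.measurableSet, hmap,
    ← sum_measureReal_singleton]
  -- The finitely many coefficients involved are uniform on the grid `S ^ n` of nonzero values, so
  -- probabilities are the counts that Schwartz-Zippel bounds.
  have hpt : ∀ x : Fin n → GaloisField 2 q,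
      (Measure.infinitePi fun _ : Fin n => uniformOn ({0}ᶜ : Set (GaloisField 2 q))).real {x} =
        if x ∈ Fintype.piFinset (fun _ : Fin n => S) then (((2 : ℝ) ^ q - 1) ^ n)⁻¹ else 0 := by
    intro x
    rw [Measure.real, Measure.infinitePi_singleton_of_fintype, ENNReal.toReal_prod]
    have : ∀ i, ((uniformOn ({0}ᶜ : Set (GaloisField 2 q))) {x i}).toReal =
      if x i = 0 then 0 else ((2 : ℝ) ^ q - 1)⁻¹ :=
      fun i => uniformOn_compl_zero_real_singleton hq (x i)
    simp only [this]
    split_ifs with hx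
    · have hx' : ∀ i, x i ≠ 0 := fun i => by
        have := Fintype.mem_piFinset.1 hx i
        simpa [hS] using this
      simp [hx']
    · have : ∃ i, x i = 0 := by
        by_contra hne
        push Not at hne
        exact hx (Fintype.mem_piFinset.2 fun i => by simp [hS, hne i])
      obtain ⟨i, hi⟩ := this
      exact Finset.prod_eq_zero (Finset.mem_univ i) (by simp [hi])
  simp only [hpt]
  rw [← Finset.sum_filter, Finset.sum_const, nsmul_eq_mul]
  have hsz := MvPolynomial.schwartz_zippel_totalDegree
    (p := P.map (algebraMap (ZMod 2) (GaloisField 2 q)))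
    ((map_ne_zero_iff _ (MvPolynomial.map_injective _
      (algebraMap (ZMod 2) (GaloisField 2 q)).injective)).2 hP) S
  have hfilter : Z.filter (fun x => x ∈ Fintype.piFinset fun _ : Fin n => S) =
      (Fintype.piFinset fun _ : Fin n => S).filter fun x =>
        MvPolynomial.eval x (P.map (algebraMap (ZMod 2) (GaloisField 2 q))) = 0 := by
    ext x
    simp only [hZ, Finset.mem_filter, Finset.mem_univ, true_and]
    rw [and_comm, MvPolynomial.eval_map, MvPolynomial.aeval_def]
  have hsz' : ((Z.filter fun x => x ∈ Fintype.piFinset fun _ : Fin n => S).card : ℝ) /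
      (S.card : ℝ) ^ n ≤ (P.map (algebraMap (ZMod 2) (GaloisField 2 q))).totalDegree /
        (S.card : ℝ) := by
    rw [hfilter]
    have := (NNRat.cast_le (K := ℝ)).2 hsz
    push_cast at this
    exact this
  rw [hScard] at hsz'
  rw [← div_eq_mul_inv]
  refine hsz'.trans ?_
  have h1 : (1 : ℝ) ≤ 2 ^ q := by exact_mod_cast hone
  have : (P.map (algebraMap (ZMod 2) (GaloisField 2 q))).totalDegree ≤ P.totalDegree :=
    Finset.sup_mono (MvPolynomial.support_map_subset _ _)
  gcongr

theorem tendsto_coeffMeasure_real_aeval_eq_zero {K N : ℕ}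
    {P : MvPolynomial (CoeffIndex K N) (ZMod 2)} (hP : P ≠ 0) :
    Tendsto (fun q => (coeffMeasure K N q).real {c | MvPolynomial.aeval c P = 0}) atTop
      (𝓝 0) := by
  obtain ⟨n, f, hf, Q, rfl⟩ := MvPolynomial.exists_fin_rename P
  have hQ : Q ≠ 0 := by
    rintro rfl
    exact hP (map_zero _)
  have hlim : Tendsto (fun q : ℕ => (Q.totalDegree : ℝ) / ((2 : ℝ) ^ q - 1)) atTop (𝓝 0) :=
    Tendsto.const_div_atTop
      (tendsto_atTop_add_const_right _ (-1) (tendsto_pow_atTop_atTop_of_one_lt one_lt_two)) _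
  refine squeeze_zero' (Eventually.of_forall fun q => measureReal_nonneg) ?_ hlim
  filter_upwards [eventually_ne_atTop 0] with q hq
  exact coeffMeasure_real_aeval_eq_zero_le hf hQ hq

/-- The slot error probability in the large field size regime. -/
def genericErrorProb (K N : ℕ) (α : ℕ∞) (Δ : ℕ) (p : unitInterval) (t : ℕ) : ℝ :=
  (channelMeasure p).real {e | ¬ IsGenericallyDecodable K N α Δ e t}

/-- The actual and the generic error events differ only where the exceptional polynomial vanishes at
the random coefficients. -/
theorem tendsto_slotErrorProb (K N : ℕ) (α : ℕ∞) (Δ : ℕ) (p : unitInterval) (t : ℕ) :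
    Tendsto (fun q => slotErrorProb K N α Δ p q t) atTop
      (𝓝 (genericErrorProb K N α Δ p t)) := by
  obtain ⟨P, hP0, hP⟩ := exists_specialization_iff K N α Δ t
  have hP' : ∀ (q : ℕ) (c : CoeffIndex K N → GaloisField 2 q), MvPolynomial.aeval c P ≠ 0 →
      ∀ e, (IsDecodable K N α Δ c e t ↔ IsGenericallyDecodable K N α Δ e t) := by
    intro q c hc e
    have := hP (GaloisField 2 q) (MvPolynomial.aeval c).toRingHom hc e
    simpa using this
  have hbound : ∀ q, |slotErrorProb K N α Δ p q t - genericErrorProb K N α Δ p t| ≤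
      (coeffMeasure K N q).real {c | MvPolynomial.aeval c P = 0} := by
    intro q
    set μ := (channelMeasure p).prod (coeffMeasure K N q)
    set A : Set ((ℕ → Bool) × (CoeffIndex K N → GaloisField 2 q)) :=
      {ω | ¬ IsDecodable K N α Δ ω.2 ω.1 t} with hA
    set G : Set (ℕ → Bool) := {e | ¬ IsGenericallyDecodable K N α Δ e t} with hG
    set Z : Set (CoeffIndex K N → GaloisField 2 q) := {c | MvPolynomial.aeval c P = 0} with hZ
    have hGm : μ.real (G ×ˢ Set.univ) = genericErrorProb K N α Δ p t := by
      rw [measureReal_prod_prod, probReal_univ, mul_one]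
      rfl
    have hZm : μ.real (Set.univ ×ˢ Z) = (coeffMeasure K N q).real Z := by
      rw [measureReal_prod_prod, probReal_univ, one_mul]
    have hAG : A ⊆ (G ×ˢ Set.univ) ∪ (Set.univ ×ˢ Z) := by
      rintro ⟨e, c⟩ h
      by_cases hc : MvPolynomial.aeval c P = 0
      · exact Or.inr ⟨trivial, hc⟩
      · exact Or.inl ⟨fun hg => h ((hP' q c hc e).2 hg), trivial⟩
    have hGA : G ×ˢ Set.univ ⊆ A ∪ (Set.univ ×ˢ Z) := by
      rintro ⟨e, c⟩ ⟨h, _⟩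
      by_cases hc : MvPolynomial.aeval c P = 0
      · exact Or.inr ⟨trivial, hc⟩
      · exact Or.inl fun hg => h ((hP' q c hc e).1 hg)
    have h1 := (measureReal_mono (μ := μ) hAG).trans (measureReal_union_le _ _)
    have h2 := (measureReal_mono (μ := μ) hGA).trans (measureReal_union_le _ _)
    rw [hGm, hZm] at h1 h2
    have hsl : slotErrorProb K N α Δ p q t = μ.real A := rfl
    rw [hsl, abs_le]
    constructor <;> linarith
  rw [tendsto_iff_norm_sub_tendsto_zero]
  exact squeeze_zero (fun q => norm_nonneg _) hbound (tendsto_coeffMeasure_real_aeval_eq_zero hP0)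

theorem genericErrorProb_le_one (K N : ℕ) (α : ℕ∞) (Δ : ℕ) (p : unitInterval) (t : ℕ) :
    genericErrorProb K N α Δ p t ≤ 1 :=
  measureReal_le_one

/-- The channel law is shift invariant, and by the shift lemma a failure at slot `t` for the shifted
pattern is a failure at slot `t + 1` for the original one. -/
theorem genericErrorProb_le_succ (K N : ℕ) (α : ℕ∞) (Δ : ℕ) (p : unitInterval) {t : ℕ}
    (ht : 1 ≤ t) : genericErrorProb K N α Δ p t ≤ genericErrorProb K N α Δ p (t + 1) := by
  have hmeas : MeasurableSet {e | ¬ IsGenericallyDecodable K N α Δ e t} := by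
    refine measurableSet_setOfPred.2 (measurable_of_dependsOn_finset
      (s := Finset.Icc 1 (t + Δ)) fun e e' h => ?_)
    rw [isGenericallyDecodable_congr α Δ fun m h1 h2 => h m (by simp [h1, h2])]
  have hmap : (channelMeasure p).map (fun e => e ∘ fun n => n + 1) = channelMeasure p :=
    map_comp_infinitePi_const _ (add_left_injective 1)
  have hm : Measurable fun e : ℕ → Bool => e ∘ fun n => n + 1 :=
    measurable_pi_lambda _ fun j => measurable_pi_apply (j + 1)
  rw [genericErrorProb, ← hmap, map_measureReal_apply hm hmeas]
  refine measureReal_mono fun e he h => he ?_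
  exact IsGenericallyDecodable.shift ht h

/-- The limit over the horizon of the generic error probabilities. -/
theorem exists_tendsto_genericErrorProb (K N : ℕ) (α : ℕ∞) (Δ : ℕ) (p : unitInterval) :
    ∃ x, Tendsto (fun t => genericErrorProb K N α Δ p (t + 1)) atTop (𝓝 x) ∧
      ∀ t, genericErrorProb K N α Δ p (t + 1) ≤ x := by
  have hmono : Monotone fun t => genericErrorProb K N α Δ p (t + 1) :=
    monotone_nat_of_le_succ fun t => genericErrorProb_le_succ K N α Δ p (by omega)
  have hbdd : BddAbove (Set.range fun t => genericErrorProb K N α Δ p (t + 1)) :=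
    ⟨1, by rintro _ ⟨t, rfl⟩; exact genericErrorProb_le_one K N α Δ p _⟩
  exact ⟨_, tendsto_atTop_ciSup hmono hbdd, fun t => le_ciSup hbdd t⟩

theorem isLongTermErrorProb_of_tendsto {K N : ℕ} {α : ℕ∞} {Δ : ℕ} {p : unitInterval} {x : ℝ}
    (h : Tendsto (fun t => genericErrorProb K N α Δ p (t + 1)) atTop (𝓝 x)) :
    IsLongTermErrorProb K N α Δ p x := by
  refine ⟨fun T => 1 / (T : ℝ) * ∑ t ∈ Finset.Icc 1 T, genericErrorProb K N α Δ p t,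
    fun T => ?_, ?_⟩
  · exact (tendsto_finsetSum _ fun t _ => tendsto_slotErrorProb K N α Δ p t).const_mul _
  · have := h.cesaro
    refine this.congr fun T => ?_
    rw [one_div, Finset.range_eq_Ico, Finset.sum_Ico_add' (fun t => genericErrorProb K N α Δ p t),
      zero_add]
    rfl

/-! ### Counting erasures and deliveries -/

/-- The number of erased slots in `(a, b]`. -/
def erasedCount (e : ℕ → Bool) (a b : ℕ) : ℕ := ((Finset.Ioc a b).filter fun m => e m = true).card

/-- The number of delivered slots in `(a, b]`. -/
def deliveredCount (e : ℕ → Bool) (a b : ℕ) : ℕ :=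
  ((Finset.Ioc a b).filter fun m => e m = false).card

theorem card_filter_Ioc_succ_right (P : ℕ → Prop) [DecidablePred P] {a b : ℕ} (h : a ≤ b) :
    ((Finset.Ioc a (b + 1)).filter P).card =
      ((Finset.Ioc a b).filter P).card + if P (b + 1) then 1 else 0 := by
  have : Finset.Ioc a (b + 1) = insert (b + 1) (Finset.Ioc a b) := by
    ext m
    simp only [Finset.mem_Ioc, Finset.mem_insert]
    omega
  rw [this, Finset.filter_insert]
  split_ifs
  · rw [Finset.card_insert_of_notMem (by simp)]
  · rw [add_zero]

theorem card_filter_Ioc_succ_left (P : ℕ → Prop) [DecidablePred P] {a b : ℕ} (h : a < b) :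
    ((Finset.Ioc a b).filter P).card =
      ((Finset.Ioc (a + 1) b).filter P).card + if P (a + 1) then 1 else 0 := by
  have : Finset.Ioc a b = insert (a + 1) (Finset.Ioc (a + 1) b) := by
    ext m
    simp only [Finset.mem_Ioc, Finset.mem_insert]
    omega
  rw [this, Finset.filter_insert]
  split_ifs
  · rw [Finset.card_insert_of_notMem (by simp)]
  · rw [add_zero]

theorem card_filter_Ioc_anti (P : ℕ → Prop) [DecidablePred P] {a a' : ℕ} (b : ℕ) (h : a ≤ a') :
    ((Finset.Ioc a' b).filter P).card ≤ ((Finset.Ioc a b).filter P).card :=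
  Finset.card_le_card (Finset.filter_subset_filter _ (Finset.Ioc_subset_Ioc_left h))

theorem erasedCount_le_deliveredCount_add (e : ℕ → Bool) {a n : ℕ} (h : a ≤ n) :
    erasedCount e a n ≤ deliveredCount e a n + informationDebt e n := by
  induction n, h using Nat.le_induction with
  | base => simp [erasedCount]
  | succ n h ih =>
    unfold erasedCount deliveredCount at *
    rw [card_filter_Ioc_succ_right _ h, card_filter_Ioc_succ_right _ h]
    simp only [informationDebt]
    cases he : e (n + 1) <;> simp <;> omega

/-- While the debt is positive no delivery is wasted at the reflecting barrier, so the inequality of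
`erasedCount_le_deliveredCount_add` becomes an equality. -/
theorem deliveredCount_add_informationDebt (e : ℕ → Bool) {a m : ℕ} (h : a ≤ m)
    (ha : informationDebt e a = 0) (hpos : ∀ i, a < i → i ≤ m → 1 ≤ informationDebt e i) :
    deliveredCount e a m + informationDebt e m = erasedCount e a m := by
  induction m, h using Nat.le_induction with
  | base => simp [erasedCount, deliveredCount, ha]
  | succ m h ih =>
    have h1 := ih fun i h1 h2 => hpos i h1 (by omega)
    have h2 := hpos (m + 1) (by omega) le_rfl
    unfold erasedCount deliveredCount at *
    rw [card_filter_Ioc_succ_right _ h, card_filter_Ioc_succ_right _ h]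
    simp only [informationDebt] at h2 ⊢
    cases he : e (m + 1) <;> simp [he] at h2 ⊢ <;> omega

/-- First-in first-out matching of erased slots with later delivered slots: if the debt at time `n`
is zero, the erased slots after some slot `b` can be matched injectively with delivered slots at
most `α` later, the parity symbols of which do not involve the slots up to `b`. -/
theorem exists_matching_of_informationDebt_eq_zero {e : ℕ → Bool} {n : ℕ}
    (h : informationDebt e n = 0) (α : ℕ∞) :
    ∃ (b : ℕ) (g : ℕ → ℕ),
      (∀ u, b < u → u ≤ n → e u = true → u ≤ g u ∧ g u ≤ n ∧ e (g u) = false ∧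
        (g u : ℕ∞) ≤ u + α ∧ (b = 0 ∨ (b : ℕ∞) + α < g u)) ∧
      Set.InjOn g {u | b < u ∧ u ≤ n ∧ e u = true} ∧ (b = 0 ∨ (b : ℕ∞) + α < n) := by
  classical
  -- Counted backwards from `n`, the `j`-th erased slot is matched with the `j`-th delivered slot.
  -- Debt zero at `n` gives at least as many deliveries as erasures in `[u, n]`, hence `u ≤ g u`;
  -- the rule preserves order.
  set g : ℕ → ℕ := fun u =>
    Nat.findGreatest (fun τ => erasedCount e (u - 1) n ≤ deliveredCount e (τ - 1) n) n with hg
  have hcount : ∀ u, u ≤ n → erasedCount e (u - 1) n ≤ deliveredCount e (u - 1) n := fun u hu => by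
    have := erasedCount_le_deliveredCount_add e (a := u - 1) (n := n) (by omega)
    omega
  have hle : ∀ u, g u ≤ n := fun u => Nat.findGreatest_le n
  have hge : ∀ u, u ≤ n → u ≤ g u := fun u hu => Nat.le_findGreatest hu (hcount u hu)
  have hspec : ∀ u, u ≤ n → erasedCount e (u - 1) n ≤ deliveredCount e (g u - 1) n :=
    fun u hu => Nat.findGreatest_spec
      (P := fun τ => erasedCount e (u - 1) n ≤ deliveredCount e (τ - 1) n) hu (hcount u hu)
  have hpos : ∀ u, 1 ≤ u → u ≤ n → e u = true →
      erasedCount e (u - 1) n = erasedCount e u n + 1 := fun u h1 h2 h3 => by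
    unfold erasedCount
    rw [card_filter_Ioc_succ_left _ (by omega : u - 1 < n), Nat.sub_add_cancel h1, if_pos h3]
  have hlt : ∀ u, 1 ≤ u → u ≤ n → e u = true →
      deliveredCount e (g u) n < erasedCount e (u - 1) n := by
    intro u h1 h2 h3
    rcases (hle u).eq_or_lt with hn | hn
    · rw [hn, hpos u h1 h2 h3]
      simp [deliveredCount]
    · have := Nat.findGreatest_is_greatest
        (P := fun τ => erasedCount e (u - 1) n ≤ deliveredCount e (τ - 1) n)
        (Nat.lt_succ_self (g u)) hn
      simpa using this
  have hsplit : ∀ u, 1 ≤ u → u ≤ n → deliveredCount e (g u - 1) n =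
      deliveredCount e (g u) n + if e (g u) = false then 1 else 0 := fun u h1 h2 => by
    have := hge u h2
    have := hle u
    unfold deliveredCount
    rw [card_filter_Ioc_succ_left _ (by omega : g u - 1 < n), Nat.sub_add_cancel (by omega)]
  have hdel : ∀ u, 1 ≤ u → u ≤ n → e u = true → e (g u) = false := by
    intro u h1 h2 h3
    by_contra hc
    have a := hsplit u h1 h2
    rw [if_neg hc] at a
    have := hlt u h1 h2 h3
    have := hspec u h2
    omega
  have heq : ∀ u, 1 ≤ u → u ≤ n → e u = true →
      deliveredCount e (g u - 1) n = erasedCount e (u - 1) n := by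
    intro u h1 h2 h3
    have a := hsplit u h1 h2
    rw [if_pos (hdel u h1 h2 h3)] at a
    have := hlt u h1 h2 h3
    have := hspec u h2
    omega
  have hmono : ∀ u u', 1 ≤ u → u < u' → u' ≤ n → e u = true → e u' = true → g u < g u' := by
    intro u u' h1 h2 h3 h4 h5
    have a := heq u h1 (by omega) h4
    have b := heq u' (by omega) h3 h5
    have c := hpos u h1 (by omega) h4
    have d : erasedCount e (u' - 1) n ≤ erasedCount e u n :=
      card_filter_Ioc_anti _ n (by omega)
    by_contra hcon
    have f : deliveredCount e (g u - 1) n ≤ deliveredCount e (g u' - 1) n :=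
      card_filter_Ioc_anti _ n (by omega)
    omega
  -- The cut `b` is the last erased slot whose match comes too late for memory `α`. By monotonicity
  -- all later matches exceed `b + α`, so their parities contain nothing from slots up to `b`.
  set Q : ℕ → Prop := fun u => 1 ≤ u ∧ e u = true ∧ (u : ℕ∞) + α < g u with hQ
  set b := Nat.findGreatest Q n with hb
  have hbn : b ≤ n := Nat.findGreatest_le n
  have hbQ : b ≠ 0 → Q b := fun h0 => Nat.findGreatest_of_ne_zero hb.symm h0
  refine ⟨b, g, fun u h1 h2 h3 => ⟨hge u h2, hle u, hdel u (by omega) h2 h3, ?_, ?_⟩, ?_, ?_⟩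
  · have := Nat.findGreatest_is_greatest (P := Q) h1 h2
    by_contra hc
    exact this ⟨by omega, h3, not_le.1 hc⟩
  · by_cases h0 : b = 0
    · exact Or.inl h0
    · obtain ⟨a1, a2, a3⟩ := hbQ h0
      refine Or.inr (a3.trans ?_)
      exact_mod_cast hmono b u a1 h1 h2 a2 h3
  · rintro u ⟨h1, h2, h3⟩ u' ⟨h1', h2', h3'⟩ hgu
    rcases lt_trichotomy u u' with hl | hl | hl
    · exact absurd hgu (hmono u u' (by omega) hl h2' h3 h3').ne
    · exact hl
    · exact absurd hgu.symm (hmono u' u (by omega) hl h2 h3' h3).ne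
  · by_cases h0 : b = 0
    · exact Or.inl h0
    · exact Or.inr ((hbQ h0).2.2.trans_le (by exact_mod_cast hle b))

/-- If every initial segment of `D` is at most as large as that of `E`, the elements of `D` can be
matched injectively with smaller or equal elements of `E`. -/
theorem exists_injOn_le_of_card_filter_le (D E : Finset ℕ)
    (h : ∀ τ ∈ D, (D.filter (· ≤ τ)).card ≤ (E.filter (· ≤ τ)).card) :
    ∃ f : ℕ → ℕ, (∀ τ ∈ D, f τ ∈ E ∧ f τ ≤ τ) ∧ Set.InjOn f D := by
  induction D using Finset.induction_on_max with
  | empty => exact ⟨id, by simp, by simp⟩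
  | insert a D ha ih =>
    have haD : a ∉ D := fun h => lt_irrefl a (ha a h)
    obtain ⟨f, hf, hinj⟩ := ih fun τ hτ => by
      refine le_trans (Finset.card_le_card ?_) (h τ (Finset.mem_insert_of_mem hτ))
      exact Finset.filter_subset_filter _ (Finset.subset_insert _ _)
    have hcard := h a (Finset.mem_insert_self _ _)
    rw [Finset.filter_true_of_mem (fun x hx => by
      rcases Finset.mem_insert.1 hx with rfl | hx
      · exact le_rfl
      · exact (ha x hx).le), Finset.card_insert_of_notMem haD] at hcard
    -- The new element `a` is the largest, so the hypothesis at `a` counts all of `D` and leaves an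
    -- unused element of `E` below it.
    have hlt : (D.image f).card < (E.filter (· ≤ a)).card :=
      lt_of_le_of_lt Finset.card_image_le hcard
    obtain ⟨x, hxE, hxD⟩ := Finset.exists_mem_notMem_of_card_lt_card hlt
    rw [Finset.mem_filter] at hxE
    have hfa : ∀ τ ∈ D, Function.update f a x τ = f τ := fun τ hτ =>
      Function.update_of_ne (ne_of_mem_of_not_mem hτ haD) _ _
    refine ⟨Function.update f a x, fun τ hτ => ?_, ?_⟩
    · rcases Finset.mem_insert.1 hτ with rfl | hτ
      · simpa using hxE
      · rw [hfa τ hτ]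
        exact hf τ hτ
    · rw [Finset.coe_insert, Set.injOn_insert (by simpa using haD)]
      refine ⟨fun τ hτ τ' hτ' hh => ?_, ?_⟩
      · rw [hfa τ hτ, hfa τ' hτ'] at hh
        exact hinj hτ hτ' hh
      · rintro ⟨τ, hτ, hh⟩
        rw [hfa τ hτ, Function.update_self] at hh
        exact hxD (Finset.mem_image.2 ⟨τ, hτ, hh⟩)

/-! ### Generic square systems -/

/-- Setting the diagonal variables to 1 and all others to 0 gives the identity matrix. By `hx` no
off-diagonal entry carries a diagonal variable. -/
theorem det_generic_ne_zero {σ ι : Type*} [Fintype ι] [DecidableEq ι] (x : ι → ι → σ)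
    (hx : ∀ i j k, x i j = x k k → i = j) (B : Matrix ι ι (MvPolynomial σ (ZMod 2)))
    (hdiag : ∀ i, B i i = MvPolynomial.X (x i i))
    (hB : ∀ i j, B i j = MvPolynomial.X (x i j) ∨ B i j = 0) : B.det ≠ 0 := by
  classical
  intro h
  set φ : MvPolynomial σ (ZMod 2) →+* ZMod 2 :=
    MvPolynomial.eval fun y => if ∃ k, y = x k k then 1 else 0 with hφ
  have h1 : φ.mapMatrix B = 1 := by
    ext i j
    rw [RingHom.mapMatrix_apply, Matrix.map_apply]
    by_cases hij : i = j
    · subst hij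
      rw [hdiag, Matrix.one_apply_eq, hφ, MvPolynomial.eval_X, if_pos ⟨i, rfl⟩]
    · rw [Matrix.one_apply_ne hij]
      rcases hB i j with hb | hb
      · rw [hb, hφ, MvPolynomial.eval_X, if_neg]
        rintro ⟨k, hk⟩
        exact hij (hx i j k hk)
      · rw [hb, map_zero]
  have h2 := RingHom.map_det φ B
  rw [h, map_zero, h1, Matrix.det_one] at h2
  exact zero_ne_one h2

/-- The index of the `j`-th parity symbol of a packet. -/
def parityIndex {K : ℕ} (j : Fin K) : Fin (2 * K) := ⟨K + j, by omega⟩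

theorem parityIndex_injective {K : ℕ} : Function.Injective (parityIndex : Fin K → Fin (2 * K)) := by
  intro i j h
  simp only [parityIndex, Fin.mk.injEq] at h
  exact Fin.ext (by omega)

theorem exists_eq_parityIndex {K : ℕ} (i : Fin (2 * K)) (h : ¬ (i : ℕ) < K) :
    ∃ j : Fin K, i = parityIndex j :=
  ⟨⟨i - K, by omega⟩, Fin.ext (by simp only [parityIndex]; omega)⟩

theorem polynomialGenerator_parityIndex {K : ℕ} (α : ℕ∞) (τ : ℕ) (j : Fin K) (v : ℕ × Fin K) :
    polynomialGenerator K (2 * K) α (τ, parityIndex j) v =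
      if 1 ≤ v.1 ∧ v.1 ≤ τ ∧ (τ : ℕ∞) ≤ (v.1 : ℕ∞) + α then
        MvPolynomial.X ((τ, parityIndex j), v) else 0 := by
  simp [polynomialGenerator, parityIndex]

/-- A square block of the generic generator matrix with a perfect matching of rows and columns is
invertible. -/
theorem isUnit_det_generic_block {K : ℕ} (α : ℕ∞) {ι : Type*} [Fintype ι] [DecidableEq ι]
    (row : ι → ℕ × Fin K) (col : ι → ℕ × Fin K) (hcol : Function.Injective col)
    (hrow : Function.Injective row)
    (hmatch : ∀ i, 1 ≤ (col i).1 ∧ (col i).1 ≤ (row i).1 ∧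
      ((row i).1 : ℕ∞) ≤ ((col i).1 : ℕ∞) + α) :
    IsUnit (Matrix.of fun i j => cumulativeGenerator K (2 * K) α (genericCoeff K (2 * K))
      ((row i).1, parityIndex (row i).2) (col j)).det := by
  rw [isUnit_iff_ne_zero]
  set B : Matrix ι ι (MvPolynomial (CoeffIndex K (2 * K)) (ZMod 2)) := Matrix.of fun i j =>
    polynomialGenerator K (2 * K) α ((row i).1, parityIndex (row i).2) (col j) with hB
  have hmap : (Matrix.of fun i j => cumulativeGenerator K (2 * K) α (genericCoeff K (2 * K))
      ((row i).1, parityIndex (row i).2) (col j)) =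
      (algebraMap _ (GenericField K (2 * K))).mapMatrix B := by
    ext i j
    simp [hB, cumulativeGenerator_genericCoeff]
  have hdet : B.det ≠ 0 := by
    refine det_generic_ne_zero
      (fun i j => (((row i).1, parityIndex (row i).2), col j)) ?_ B (fun i => ?_) fun i j => ?_
    · intro i j k h
      simp only [Prod.mk.injEq] at h
      have h1 : i = k := hrow (Prod.ext h.1.1 (parityIndex_injective h.1.2))
      rw [h1, hcol h.2]
    · rw [hB, Matrix.of_apply, polynomialGenerator_parityIndex, if_pos (hmatch i)]
    · rw [hB, Matrix.of_apply, polynomialGenerator_parityIndex]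
      split_ifs
      · exact Or.inl rfl
      · exact Or.inr rfl
  rw [hmap, ← RingHom.map_det]
  exact fun h => hdet (IsFractionRing.injective (MvPolynomial (CoeffIndex K (2 * K)) (ZMod 2))
    (GenericField K (2 * K)) (by rw [h, map_zero]))

/-! ### Generic decodability and the information debt -/

theorem receiverRowSpace_mono {K N : ℕ} (α : ℕ∞) {F : Type*} [Field F] (c : CoeffIndex K N → F)
    (e : ℕ → Bool) {m n : ℕ} (h : m ≤ n) :
    receiverRowSpace K N α c e m ≤ receiverRowSpace K N α c e n :=
  Submodule.span_mono (Set.image_mono fun _ hr => ⟨hr.1, hr.2.1.trans h, hr.2.2⟩)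

theorem single_mem_receiverRowSpace_of_delivered {K : ℕ} (α : ℕ∞) {F : Type*} [Field F]
    (c : CoeffIndex K (2 * K) → F) {e : ℕ → Bool} {n : ℕ} {v : ℕ × Fin K} (h1 : 1 ≤ v.1)
    (hn : v.1 ≤ n) (he : e v.1 = false) :
    (Pi.single v 1 : ℕ × Fin K → F) ∈ receiverRowSpace K (2 * K) α c e n := by
  refine Submodule.subset_span ⟨(v.1, ⟨v.2, by omega⟩), ⟨h1, hn, he⟩, ?_⟩
  ext ⟨s, j⟩
  simp only [Matrix.row, cumulativeGenerator, v.2.2, if_true, Pi.single_apply, Prod.ext_iff,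
    Fin.ext_iff]

/-- When the information debt is zero, the source vectors of the last `α` slots are determined. -/
theorem single_mem_receiverRowSpace_of_informationDebt_eq_zero {K : ℕ} {α : ℕ∞} {e : ℕ → Bool}
    {n : ℕ} (h : informationDebt e n = 0) {v : ℕ × Fin K} (h1 : 1 ≤ v.1) (hn : v.1 ≤ n)
    (hα : (n : ℕ∞) < v.1 + α) :
    (Pi.single v 1 : ℕ × Fin K → GenericField K (2 * K)) ∈
      receiverRowSpace K (2 * K) α (genericCoeff K (2 * K)) e n := by
  classical
  obtain ⟨b, g, hg, hinj, hb⟩ := exists_matching_of_informationDebt_eq_zero h α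
  by_cases he : e v.1 = false
  · exact single_mem_receiverRowSpace_of_delivered α _ h1 hn he
  rw [Bool.not_eq_false] at he
  -- Otherwise `b + α < n < v.1 + α ≤ b + α`.
  have hbv : b < v.1 := by
    rcases hb with rfl | hb
    · exact h1
    · by_contra hcon
      have : (v.1 : ℕ∞) ≤ b := by exact_mod_cast not_lt.1 hcon
      exact lt_irrefl _ ((hb.trans hα).trans_le (add_le_add_left this α))
  set W := receiverRowSpace K (2 * K) α (genericCoeff K (2 * K)) e n with hW
  set V : Finset (ℕ × Fin K) :=
    ((Finset.Ioc b n).filter fun u => e u = true) ×ˢ Finset.univ with hV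
  have hVmem : ∀ u : ℕ × Fin K, u ∈ V ↔ b < u.1 ∧ u.1 ≤ n ∧ e u.1 = true := fun u => by
    simp [hV, and_assoc]
  set G := cumulativeGenerator K (2 * K) α (genericCoeff K (2 * K)) with hG
  set A : Matrix V V (GenericField K (2 * K)) :=
    Matrix.of fun i j => G (g i.1.1, parityIndex i.1.2) j.1 with hA
  have hunit : IsUnit A.det := by
    refine isUnit_det_generic_block α (fun i : V => (g i.1.1, i.1.2)) (fun i => i.1)
      Subtype.val_injective ?_ fun i => ?_
    · rintro ⟨i, hi⟩ ⟨j, hj⟩ hij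
      simp only [Prod.mk.injEq] at hij
      exact Subtype.ext (Prod.ext (hinj ((hVmem i).1 hi) ((hVmem j).1 hj) hij.1) hij.2)
    · obtain ⟨a1, a2, a3⟩ := (hVmem i.1).1 i.2
      obtain ⟨b1, b2, b3, b4, b5⟩ := hg _ a1 a2 a3
      exact ⟨by omega, b1, b4⟩
  have hy : ∀ i : V, ∑ j : V, A i j •
      (Pi.single j.1 1 : ℕ × Fin K → GenericField K (2 * K)) ∈ W := by
    intro i
    obtain ⟨a1, a2, a3⟩ := (hVmem i.1).1 i.2
    obtain ⟨b1, b2, b3, b4, b5⟩ := hg _ a1 a2 a3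
    have hrowmem : G.row (g i.1.1, parityIndex i.1.2) ∈ W :=
      Submodule.subset_span ⟨_, ⟨by simp; omega, b2, b3⟩, rfl⟩
    rw [hG, row_eq_sum_single α _ _ (n := n) b2, ← Finset.sum_filter_add_sum_filter_not _
      (fun u => u ∈ V)] at hrowmem
    -- Outside `V` the parity row meets only delivered slots, whose unit rows are received, and
    -- slots up to `b`, which have left the memory window.
    have hrest : ∑ u ∈ (Finset.range (n + 1) ×ˢ (Finset.univ : Finset (Fin K))).filter
        (fun u => ¬ u ∈ V), G (g i.1.1, parityIndex i.1.2) u •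
          (Pi.single u 1 : ℕ × Fin K → GenericField K (2 * K)) ∈ W := by
      refine Submodule.sum_mem _ fun u hu => ?_
      rw [Finset.mem_filter, Finset.mem_product, Finset.mem_range, hVmem] at hu
      by_cases hz : 1 ≤ u.1 ∧ u.1 ≤ g i.1.1 ∧ (g i.1.1 : ℕ∞) ≤ (u.1 : ℕ∞) + α
      · refine Submodule.smul_mem _ _ (single_mem_receiverRowSpace_of_delivered α _ hz.1
          (by omega) ?_)
        by_contra hc
        rw [Bool.not_eq_false] at hc
        refine hu.2 ⟨?_, by omega, hc⟩
        rcases b5 with rfl | b5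
        · exact hz.1
        · by_contra hcon
          have : (u.1 : ℕ∞) ≤ b := by exact_mod_cast not_lt.1 hcon
          exact lt_irrefl _ ((b5.trans_le hz.2.2).trans_le (add_le_add_left this α))
      · have : G (g i.1.1, parityIndex i.1.2) u = 0 := by
          rw [hG, cumulativeGenerator_genericCoeff, polynomialGenerator_parityIndex, if_neg hz,
            map_zero]
        rw [this, zero_smul]
        exact Submodule.zero_mem _
    have hfirst := (Submodule.add_mem_iff_left _ hrest).1 hrowmem
    have hfilter : (Finset.range (n + 1) ×ˢ (Finset.univ : Finset (Fin K))).filter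
        (fun u => u ∈ V) = V := by
      ext u
      rw [Finset.mem_filter, Finset.mem_product, Finset.mem_range, hVmem]
      constructor
      · exact fun h => h.2
      · exact fun h => ⟨⟨by omega, Finset.mem_univ _⟩, h⟩
    rw [hfilter, ← Finset.sum_coe_sort] at hfirst
    exact hfirst
  have hv : v ∈ V := (hVmem v).2 ⟨hbv, hn, he⟩
  -- Solve the square system for the erased symbols with the inverse of `A`.
  have hsingle : (Pi.single v 1 : ℕ × Fin K → GenericField K (2 * K)) =
      ∑ i : V, A⁻¹ ⟨v, hv⟩ i • ∑ j : V, A i j •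
        (Pi.single j.1 1 : ℕ × Fin K → GenericField K (2 * K)) := by
    simp only [Finset.smul_sum, smul_smul]
    rw [Finset.sum_comm]
    simp only [← Finset.sum_smul]
    have : ∀ j : V, ∑ i : V, A⁻¹ ⟨v, hv⟩ i * A i j = (1 : Matrix V V _) ⟨v, hv⟩ j := fun j => by
      rw [← Matrix.mul_apply, Matrix.nonsing_inv_mul _ hunit]
    simp only [this]
    rw [Finset.sum_eq_single ⟨v, hv⟩]
    · simp
    · intro j _ hj
      simp [Matrix.one_apply_ne hj.symm]
    · simp
  rw [hsingle]
  exact Submodule.sum_mem _ fun i _ => Submodule.smul_mem _ _ (hy i)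

/-- If the information debt stays positive after the erasure of slot `t`, then `s(t)` is not
determined. -/
theorem single_not_mem_receiverRowSpace_of_informationDebt_pos {K : ℕ} {e : ℕ → Bool}
    {t n : ℕ} (he : e t = true) (ht : 1 ≤ t) (htn : t ≤ n)
    (hpos : ∀ i, t ≤ i → i ≤ n → 1 ≤ informationDebt e i) (k : Fin K) :
    (Pi.single (t, k) 1 : ℕ × Fin K → GenericField K (2 * K)) ∉
      receiverRowSpace K (2 * K) ⊤ (genericCoeff K (2 * K)) e n := by
  classical
  obtain ⟨t₀, ht₀, hz, hpos'⟩ : ∃ t₀, t₀ < t ∧ informationDebt e t₀ = 0 ∧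
      ∀ i, t₀ < i → i ≤ n → 1 ≤ informationDebt e i := by
    -- The last time before `t` with debt zero, which exists because the debt starts at 0.
    set t₀ := Nat.findGreatest (fun i => informationDebt e i = 0) (t - 1) with h0
    have h1 : t₀ ≤ t - 1 := Nat.findGreatest_le _
    refine ⟨t₀, by omega, Nat.findGreatest_spec (P := fun i => informationDebt e i = 0)
      (Nat.zero_le _) rfl, fun i hi hin => ?_⟩
    by_cases hit : t ≤ i
    · exact hpos i hit hin
    · exact Nat.pos_of_ne_zero (Nat.findGreatest_is_greatest
        (P := fun i => informationDebt e i = 0) hi (by omega))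
  set D : Finset ℕ := (Finset.Ioc t₀ n).filter fun m => e m = false with hD
  -- Slot `t` is reserved as a free unknown. As the debt is at least 1, deliveries in `(t₀, τ]` are
  -- fewer than erasures there, so they can still be matched with earlier erased slots other than
  -- `t`.
  set E : Finset ℕ := ((Finset.Ioc t₀ n).filter fun m => e m = true).erase t with hE
  obtain ⟨f, hf, hinj⟩ := exists_injOn_le_of_card_filter_le D E fun τ hτ => by
    rw [hD, Finset.mem_filter, Finset.mem_Ioc] at hτ
    have a := deliveredCount_add_informationDebt e hτ.1.1.le hz
      fun i h1 h2 => hpos' i h1 (by omega)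
    have b := hpos' τ hτ.1.1 hτ.1.2
    have c : D.filter (· ≤ τ) = (Finset.Ioc t₀ τ).filter fun m => e m = false := by
      ext m
      simp only [hD, Finset.mem_filter, Finset.mem_Ioc]
      constructor
      · rintro ⟨⟨⟨h1, h2⟩, h3⟩, h4⟩
        exact ⟨⟨h1, h4⟩, h3⟩
      · rintro ⟨⟨h1, h4⟩, h3⟩
        exact ⟨⟨⟨h1, by omega⟩, h3⟩, h4⟩
    have d : ((Finset.Ioc t₀ τ).filter fun m => e m = true).erase t ⊆ E.filter (· ≤ τ) := by
      intro m hm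
      simp only [hE, Finset.mem_erase, Finset.mem_filter, Finset.mem_Ioc] at hm ⊢
      exact ⟨⟨hm.1, ⟨hm.2.1.1, by omega⟩, hm.2.2⟩, hm.2.1.2⟩
    have d1 := Finset.card_le_card d
    have d2 := Finset.pred_card_le_card_erase
      (s := (Finset.Ioc t₀ τ).filter fun m => e m = true) (a := t)
    rw [c]
    unfold deliveredCount erasedCount at a
    omega
  have hfE : ∀ τ ∈ D, f τ ≠ t ∧ t₀ < f τ ∧ f τ ≤ n ∧ e (f τ) = true ∧ f τ ≤ τ := fun τ hτ => by
    have h := hf τ hτ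
    simp only [hE, Finset.mem_erase, Finset.mem_filter, Finset.mem_Ioc] at h
    exact ⟨h.1.1, h.1.2.1.1, h.1.2.1.2, h.1.2.2, h.2⟩
  set V : Finset (ℕ × Fin K) := D ×ˢ Finset.univ with hV
  have hVD : ∀ i : V, i.1.1 ∈ D := fun i => (Finset.mem_product.1 i.2).1
  set G := cumulativeGenerator K (2 * K) ⊤ (genericCoeff K (2 * K)) with hG
  set col : V → ℕ × Fin K := fun i => (f i.1.1, i.1.2) with hcol
  set A : Matrix V V (GenericField K (2 * K)) :=
    Matrix.of fun i j => G (i.1.1, parityIndex i.1.2) (col j) with hA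
  have hunit : IsUnit A.det := by
    refine isUnit_det_generic_block ⊤ (fun i : V => i.1) col ?_ Subtype.val_injective fun i => ?_
    · rintro ⟨i, hi⟩ ⟨j, hj⟩ hij
      simp only [hcol, Prod.mk.injEq] at hij
      exact Subtype.ext (Prod.ext (hinj (hVD ⟨i, hi⟩) (hVD ⟨j, hj⟩) hij.1) hij.2)
    · obtain ⟨h1, h2, h3, h4, h5⟩ := hfE _ (hVD i)
      exact ⟨by simp only [hcol]; omega, h5, by simp⟩
  set β : V → GenericField K (2 * K) := fun i => G (i.1.1, parityIndex i.1.2) (t, k) with hβ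
  set z : V → GenericField K (2 * K) := -(A⁻¹.mulVec β) with hzdef
  have hAz : ∀ i, β i + ∑ j, A i j * z j = 0 := by
    intro i
    have : A.mulVec z = -β := by
      rw [hzdef, Matrix.mulVec_neg, Matrix.mulVec_mulVec, Matrix.mul_nonsing_inv _ hunit,
        Matrix.one_mulVec]
    have := congrFun this i
    rw [Matrix.mulVec, dotProduct, Pi.neg_apply] at this
    rw [this, add_neg_cancel]
  -- The kernel vector is 1 at `(t, k)`, solves the parity equations after `t₀` through the matched
  -- columns, and is 0 elsewhere.
  refine not_mem_receiverRowSpace_of_kernel ⊤ _ e n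
    (fun u => (if u = (t, k) then 1 else 0) + ∑ j : V, if u = col j then z j else 0)
    (v := (t, k)) htn ?_ fun r hr1 hr2 hr3 => ?_
  · rw [if_pos rfl, Finset.sum_eq_zero, add_zero]
    · exact one_ne_zero
    · intro j _
      rw [if_neg]
      intro hh
      exact (hfE _ (hVD j)).1 (congrArg Prod.fst hh).symm
  · rw [← hG]
    have hsum : ∑ u ∈ Finset.range (n + 1) ×ˢ Finset.univ, G r u *
        ((if u = (t, k) then 1 else 0) + ∑ j : V, if u = col j then z j else 0) =
        G r (t, k) + ∑ j : V, G r (col j) * z j := by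
      simp only [mul_add, Finset.sum_add_distrib, Finset.mul_sum]
      congr 1
      · rw [Finset.sum_eq_single (t, k)]
        · simp
        · intro u _ hu
          simp [hu]
        · intro hh
          simp at hh
          omega
      · rw [Finset.sum_comm]
        refine Finset.sum_congr rfl fun j _ => ?_
        rw [Finset.sum_eq_single (col j)]
        · simp
        · intro u _ hu
          simp [hu]
        · intro hh
          have := (hfE _ (hVD j)).2.2.1
          simp [hcol] at hh
          omega
    rw [hsum]
    obtain ⟨τ, i⟩ := r
    simp only at hr1 hr2 hr3
    -- Systematic rows vanish on it because it lives on erased slots, parity rows up to `t₀` by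
    -- causality, and the remaining parity rows by the choice of `z`.
    by_cases hi : (i : ℕ) < K
    · have hzero : ∀ u : ℕ × Fin K, e u.1 = true → G (τ, i) u = 0 := by
        intro u hu
        have : u.1 ≠ τ := by
          rintro rfl
          rw [hr3] at hu
          exact Bool.false_ne_true hu
        simp [hG, cumulativeGenerator, hi, this]
      rw [hzero (t, k) he, zero_add]
      exact Finset.sum_eq_zero fun j _ => by
        rw [hzero (col j) (hfE _ (hVD j)).2.2.2.1, zero_mul]
    · obtain ⟨j, rfl⟩ := exists_eq_parityIndex i hi
      by_cases hτ : τ ≤ t₀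
      · rw [hG, cumulativeGenerator_eq_zero_of_lt _ _ (by simp only; omega), zero_add]
        refine Finset.sum_eq_zero fun j _ => ?_
        have := (hfE _ (hVD j)).2.1
        rw [cumulativeGenerator_eq_zero_of_lt _ _ (by simp only [hcol]; omega), zero_mul]
      · have hmem : (τ, j) ∈ V := by
          simp only [hV, hD, Finset.mem_product, Finset.mem_filter, Finset.mem_Ioc,
            Finset.mem_univ, and_true]
          exact ⟨⟨by omega, hr2⟩, hr3⟩
        exact hAz ⟨(τ, j), hmem⟩

theorem isGenericallyDecodable_of_informationDebt_eq_zero {K : ℕ} {α : ℕ∞} {Δ : ℕ}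
    {e : ℕ → Bool} {t n : ℕ} (ht : 1 ≤ t) (htn : t ≤ n) (hn : n ≤ t + Δ)
    (h : informationDebt e n = 0) (hα : (Δ : ℕ∞) < α) :
    IsGenericallyDecodable K (2 * K) α Δ e t := by
  intro k
  refine receiverRowSpace_mono α _ e hn
    (single_mem_receiverRowSpace_of_informationDebt_eq_zero h (v := (t, k)) ht htn ?_)
  calc (n : ℕ∞) ≤ (t : ℕ∞) + Δ := by exact_mod_cast hn
    _ < t + α := (ENat.add_lt_add_iff_left (ENat.natCast_ne_top t)).2 hα

theorem isGenericallyDecodable_of_delivered {K : ℕ} {α : ℕ∞} {Δ : ℕ}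
    {e : ℕ → Bool} {t : ℕ} (ht : 1 ≤ t) (he : e t = false) :
    IsGenericallyDecodable K (2 * K) α Δ e t :=
  fun k => single_mem_receiverRowSpace_of_delivered α _ (v := (t, k)) ht (by simp) he

/-- For unlimited memory, `s(t)` is lost exactly if it is erased and the information debt does not
return to zero in time. -/
theorem not_isGenericallyDecodable_top_iff {K : ℕ} (hK : 1 ≤ K) {Δ : ℕ} {e : ℕ → Bool} {t : ℕ}
    (ht : 1 ≤ t) :
    ¬ IsGenericallyDecodable K (2 * K) ⊤ Δ e t ↔
      e t = true ∧ ∀ i, t ≤ i → i ≤ t + Δ → 1 ≤ informationDebt e i := by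
  constructor
  · refine fun h => ⟨?_, fun i h1 h2 => ?_⟩
    · by_contra he
      exact h (isGenericallyDecodable_of_delivered ht (by simpa using he))
    · by_contra hi
      exact h (isGenericallyDecodable_of_informationDebt_eq_zero ht h1 h2 (by omega)
        (ENat.natCast_lt_top Δ))
  · rintro ⟨he, hpos⟩ h
    exact single_not_mem_receiverRowSpace_of_informationDebt_pos he ht (Nat.le_add_right t Δ) hpos
      ⟨0, hK⟩ (h _)

/-! ### Finite memory compared with unlimited memory -/

theorem isGenericallyDecodable_iff_top {K N : ℕ} {α : ℕ∞} {Δ : ℕ} {e : ℕ → Bool} {t : ℕ}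
    (h : ((t + Δ : ℕ) : ℕ∞) ≤ α) :
    IsGenericallyDecodable K N α Δ e t ↔ IsGenericallyDecodable K N ⊤ Δ e t := by
  have : receiverRowSpace K N α (genericCoeff K N) e (t + Δ) =
      receiverRowSpace K N ⊤ (genericCoeff K N) e (t + Δ) := by
    unfold receiverRowSpace
    congr 1
    refine Set.image_congr fun r hr => ?_
    ext v
    have h1 : (r.1 : ℕ∞) ≤ (v.1 : ℕ∞) + α := by
      refine le_trans ?_ (h.trans le_add_self)
      exact_mod_cast hr.2.1
    simp only [Matrix.row, cumulativeGenerator, h1, add_top, le_top]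
  rw [IsGenericallyDecodable, IsGenericallyDecodable, IsDecodable, IsDecodable, this]

/-- Recovery at a zero of the debt needs only memory beyond the delay, while for unlimited memory
the absence of such a zero after an erasure already forces a loss. -/
theorem genericErrorProb_le_top {K : ℕ} (hK : 1 ≤ K) {α : ℕ∞} {Δ : ℕ} (p : unitInterval)
    (hα : (Δ : ℕ∞) < α) {t : ℕ} (ht : 1 ≤ t) :
    genericErrorProb K (2 * K) α Δ p t ≤ genericErrorProb K (2 * K) ⊤ Δ p t := by
  refine measureReal_mono fun e h => (not_isGenericallyDecodable_top_iff hK ht).2 ⟨?_, ?_⟩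
  · by_contra he
    exact h (isGenericallyDecodable_of_delivered ht (by simpa using he))
  · intro i h1 h2
    by_contra hi
    exact h (isGenericallyDecodable_of_informationDebt_eq_zero ht h1 h2 (by omega) hα)

theorem genericErrorProb_eq_top {K N : ℕ} {α : ℕ∞} {Δ : ℕ} (p : unitInterval) {t : ℕ}
    (h : ((t + Δ : ℕ) : ℕ∞) ≤ α) :
    genericErrorProb K N α Δ p t = genericErrorProb K N ⊤ Δ p t := by
  simp only [genericErrorProb, isGenericallyDecodable_iff_top h]

theorem tendsto_genericErrorProb_top {K : ℕ} (hK : 1 ≤ K) (Δ : ℕ) (p : unitInterval)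
    (hp : 1 / 2 < (p : ℝ)) :
    Tendsto (fun t => genericErrorProb K (2 * K) ⊤ Δ p (t + 1)) atTop
      (𝓝 (numeratorSeries Δ p / denominatorValue p)) := by
  rw [denominatorValue_eq hp p.2.2]
  refine (tendsto_sum_reflectedTail_mul_survivalProb Δ hp p.2.2).congr fun t => ?_
  rw [← channelMeasure_real_erased_staysPositive, genericErrorProb]
  simp only [not_isGenericallyDecodable_top_iff hK (Nat.le_add_left 1 t)]

/-- The error probability of memory `α` tends to that of unlimited memory. -/
theorem exists_tendsto_memory {K : ℕ} (hK : 1 ≤ K) (Δ : ℕ) (p : unitInterval) {x : ℝ}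
    (hx : Tendsto (fun t => genericErrorProb K (2 * K) ⊤ Δ p (t + 1)) atTop (𝓝 x)) :
    ∃ pe : ℕ → ℝ, (∀ α : ℕ, IsLongTermErrorProb K (2 * K) (α : ℕ∞) Δ p (pe α)) ∧
      Tendsto pe atTop (𝓝 x) := by
  choose pe hpe hle using fun α : ℕ =>
    exists_tendsto_genericErrorProb K (2 * K) (α : ℕ∞) Δ p
  refine ⟨pe, fun α => isLongTermErrorProb_of_tendsto (hpe α), ?_⟩
  -- With memory `α + Δ + 1` the slot `α + 1` sees no truncation up to its deadline. Its error
  -- probability for unlimited memory is therefore a lower bound that tends to `x`.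
  rw [← tendsto_add_atTop_iff_nat (Δ + 1)]
  refine tendsto_of_tendsto_of_tendsto_of_le_of_le hx tendsto_const_nhds (fun α => ?_)
    fun α => ?_
  · have h := hle (α + (Δ + 1)) α
    rwa [genericErrorProb_eq_top] at h
    exact_mod_cast (by omega : α + 1 + Δ ≤ α + (Δ + 1))
  · refine le_of_tendsto_of_tendsto' (hpe _) hx fun t =>
      genericErrorProb_le_top hK p ?_ (Nat.le_add_left 1 t)
    exact_mod_cast (by omega : Δ < α + (Δ + 1))

end

/-! ### The error probability formula -/

theorem theorem2 (K N Δ : ℕ) (hKN : (K : ℝ) / (N : ℝ) = 1 / 2)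
    (p : unitInterval) (hp : 1 / 2 < (p : ℝ)) :
    Summable (fun m : ℕ => numeratorTerm Δ p ((Δ + 1) / 2 + 1 + m)) ∧
      0 < denominatorValue p ∧
      IsLongTermErrorProb K N ⊤ Δ p (numeratorSeries Δ p / denominatorValue p) ∧
      ∃ pe : ℕ → ℝ, (∀ α : ℕ, IsLongTermErrorProb K N (α : ℕ∞) Δ p (pe α)) ∧
        Tendsto pe atTop (𝓝 (numeratorSeries Δ p / denominatorValue p)) := by
  -- Division by zero is 0, so the rate condition excludes `N = 0` and hence gives `K ≥ 1`.
  have hN0 : (N : ℝ) ≠ 0 := by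
    intro h
    rw [h, div_zero] at hKN
    norm_num at hKN
  have hN : N = 2 * K := by
    rw [div_eq_div_iff hN0 two_ne_zero] at hKN
    have : (N : ℝ) = 2 * K := by linarith
    exact_mod_cast this
  subst hN
  have hK : 1 ≤ K := by
    rcases Nat.eq_zero_or_pos K with rfl | h
    · simp at hN0
    · exact h
  have hlim := tendsto_genericErrorProb_top hK Δ p hp
  refine ⟨(hasSum_numeratorTerm Δ hp p.2.2).summable, ?_, isLongTermErrorProb_of_tendsto hlim,
    exists_tendsto_memory hK Δ p hlim⟩
  rw [denominatorValue_eq hp p.2.2]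
  exact div_pos (by linarith) (by linarith)
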